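/- Let $n,d\in\mathbb N$, let $V=\mathbb Q^n$ and $V_{\mathbb Z}=\mathbb Z^n\subset V$. Let $S(n,d)=\operatorname{End}_{\Sigma_d}(V^{\otimes d})$ be the (rational) Schur algebra, where the symmetric group $\Sigma_d$ permutes the tensor places, and let $S_{\mathbb Z}(n,d)=\operatorname{End}_{\Sigma_d}(V_{\mathbb Z}^{\otimes d})$ be the integral Schur algebra, regarded as a subring of $S(n,d)$ by extension of scalars. The Lie algebra $\mathfrak{gl}_n$ acts on $V^{\otimes d}$ by $X\mapsto\sum_{k=1}^d 1\otimes\cdots\otimes X\otimes\cdots\otimes 1$ ($X$ in place $k$). For $i\neq j$ let $x_{\varepsilon_i-\varepsilon_j}\in S(n,d)$ be the image of the matrix unit $E_{ij}$, and let $H_k\in S(n,d)$ be the image of $E_{kk}$. Put $e_j=x_{\varepsilon_j-\varepsilon_{j+1}}$ and $f_j=x_{\varepsilon_{j+1}-\varepsilon_j}$ for $1\le j\le n-1$. For $m\in\mathbb N$ write $y^{(m)}=y^m/m!$ and $\binom{y}{m}=y(y-1)\cdots(y-m+1)/m!$. For $\lambda$ in the set $\Lambda(n,d)$ of all $\lambda\in\mathbb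 N^n$ with $\lambda_1+\cdots+\lambda_n=d$, put $1_\lambda=\prod_{k=1}^n\binom{H_k}{\lambda_k}$. Let $\Phi^+=\{\varepsilon_i-\varepsilon_j : 1\le i<j\le n\}$ and $\Phi^-=-\Phi^+$. Fix any orders on $\Phi^+$ and on $\Phi^-$, and for $A=(a_\alpha),\,C=(c_\alpha)\in\mathbb N^{\Phi^+}$ put $$e_A=\prod_{\alpha\in\Phi^+}x_\alpha^{(a_\alpha)},\qquad f_C=\prod_{\alpha\in\Phi^+}x_{-\alpha}^{(c_\alpha)},$$ the products being taken in the fixed orders. Define the content $\chi$ and the opposite content $\chi'$, additively on formal products of divided powers of root vectors, by $$\chi\big(x_{\varepsilon_i-\varepsilon_j}^{(m)}\big)=m\,\varepsilon_{\max(i,j)},\qquad \chi'\big(x_{\varepsilon_i-\varepsilon_j}^{(m)}\big)=m\,\varepsilon_{\min(i,j)},$$ where $\varepsilon_1,\dots,\varepsilon_n$ is the standard basis of $\mathbb Z^n$, and let $\preceq$ be the componentwise order on $\mathbb N^n$. Then $S_{\mathbb Z}(n,d)$ is the subring of $S(n,d)$ generated by all divided powers $e_j^{(m)}$, $f_j^{(m)}$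 ($1\le j\le n-1$, $m\in\mathbb N$). Moreover, the family $$e_A\,1_\lambda\,f_C\qquad\big(A,C\in\mathbb N^{\Phi^+},\ \lambda\in\Lambda(n,d),\ \chi(e_Af_C)\preceq\lambda\big)$$ is a $\mathbb Z$-basis of $S_{\mathbb Z}(n,d)$, and so is the family $$f_A\,1_\lambda\,e_C\qquad\big(A,C\in\mathbb N^{\Phi^+},\ \lambda\in\Lambda(n,d),\ \chi'(f_Ae_C)\preceq\lambda\big).$$ -/

import Mathlib

open scoped TensorProduct Nat

set_option maxSynthPendingDepth 3

namespace Schur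

noncomputable section

/-- The `d`-th tensor power of the free module `R ^ n`. -/
abbrev TensorSpace (R : Type) [CommRing R] (n d : ℕ) : Type :=
  ⨂[R] _ : Fin d, (Fin n → R)

/-- The permutation of tensor places attached to `σ`. -/
def placePerm (R : Type) [CommRing R] (n d : ℕ) (σ : Equiv.Perm (Fin d)) :
    Module.End R (TensorSpace R n d) :=
  (PiTensorProduct.reindex R (fun _ : Fin d => (Fin n → R)) σ).toLinearMap

/-- The Schur algebra over `R`: the endomorphisms of the `d`-th tensor power of `R ^ n` that
commute with all permutations of the tensor places. -/
def schurAlgebra (R : Type) [CommRing R] (n d : ℕ) :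
    Subalgebra R (Module.End R (TensorSpace R n d)) :=
  Subalgebra.centralizer R (Set.range (placePerm R n d))

/-- The Schur algebra `S(n,d)` over the rational numbers. -/
abbrev S (n d : ℕ) : Type := schurAlgebra ℚ n d

/-- The entrywise inclusion of `ℤ ^ n` into `ℚ ^ n`. -/
def latticeIncl (n : ℕ) : (Fin n → ℤ) →ₗ[ℤ] (Fin n → ℚ) where
  toFun v := fun i => (v i : ℚ)
  map_add' v w := by ext i; simp
  map_smul' c v := by ext i; simp

/-- The canonical map from the tensor power of `ℤ ^ n` (over `ℤ`) to the tensor power of `ℚ ^ n`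
(over `ℚ`), sending `v₁ ⊗ ⋯ ⊗ v_d` to `v₁ ⊗ ⋯ ⊗ v_d`. -/
def tensorIncl (n d : ℕ) : TensorSpace ℤ n d →ₗ[ℤ] TensorSpace ℚ n d :=
  PiTensorProduct.lift
    (((PiTensorProduct.tprod ℚ (s := fun _ : Fin d => (Fin n → ℚ))).restrictScalars
      ℤ).compLinearMap (fun _ => latticeIncl n))

/-- The integral Schur algebra, as a subring of `S(n,d)`: an element of `S(n,d)` is integral when
it is the extension to the rational tensor power of an endomorphism of the tensor power
of `ℤ ^ n` that commutes with the permutations of the tensor places. -/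
def integralSchur (n d : ℕ) : Subring (S n d) where
  carrier := {T | ∃ T₀ : schurAlgebra ℤ n d, ∀ x : TensorSpace ℤ n d,
    (T : Module.End ℚ (TensorSpace ℚ n d)) (tensorIncl n d x) =
      tensorIncl n d ((T₀ : Module.End ℤ (TensorSpace ℤ n d)) x)}
  mul_mem' := by
    rintro a b ⟨a₀, ha⟩ ⟨b₀, hb⟩
    refine ⟨a₀ * b₀, fun x => ?_⟩
    simp only [MulMemClass.coe_mul, Module.End.mul_apply, hb, ha]
  one_mem' := ⟨1, fun x => by simp⟩
  add_mem' := by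
    rintro a b ⟨a₀, ha⟩ ⟨b₀, hb⟩
    exact ⟨a₀ + b₀, fun x => by simp [ha, hb]⟩
  zero_mem' := ⟨0, fun x => by simp⟩
  neg_mem' := by
    rintro a ⟨a₀, ha⟩
    exact ⟨-a₀, fun x => by simp [ha]⟩

/-- The operator `1 ⊗ ⋯ ⊗ 1 ⊗ X ⊗ 1 ⊗ ⋯ ⊗ 1` with `X` in place `k`. -/
def actAt (n d : ℕ) (X : Matrix (Fin n) (Fin n) ℚ) (k : Fin d) :
    Module.End ℚ (TensorSpace ℚ n d) :=
  PiTensorProduct.map (fun l : Fin d => if l = k then Matrix.toLin' X else LinearMap.id)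

theorem placePerm_tprod (n d : ℕ) (σ : Equiv.Perm (Fin d)) (v : Fin d → Fin n → ℚ) :
    placePerm ℚ n d σ (PiTensorProduct.tprod ℚ v) =
      PiTensorProduct.tprod ℚ (fun l => v (σ.symm l)) :=
  PiTensorProduct.reindex_tprod (s := fun _ : Fin d => (Fin n → ℚ)) σ v

theorem actAt_tprod (n d : ℕ) (X : Matrix (Fin n) (Fin n) ℚ) (k : Fin d)
    (v : Fin d → Fin n → ℚ) :
    actAt n d X k (PiTensorProduct.tprod ℚ v) =
      PiTensorProduct.tprod ℚ (fun l => if l = k then Matrix.toLin' X (v l) else v l) := by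
  rw [actAt, PiTensorProduct.map_tprod]
  congr 1
  funext l
  split_ifs <;> rfl

theorem placePerm_mul_actAt (n d : ℕ) (X : Matrix (Fin n) (Fin n) ℚ) (σ : Equiv.Perm (Fin d))
    (k : Fin d) :
    placePerm ℚ n d σ * actAt n d X k = actAt n d X (σ k) * placePerm ℚ n d σ := by
  refine PiTensorProduct.ext (MultilinearMap.ext fun v => ?_)
  simp only [LinearMap.compMultilinearMap_apply, Module.End.mul_apply, placePerm_tprod,
    actAt_tprod, Equiv.symm_apply_eq]

/-- The action of a matrix `X` in `gl_n` on the tensor power, `∑ₖ 1 ⊗ ⋯ ⊗ X ⊗ ⋯ ⊗ 1`, as an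
element of `S(n,d)`. This is the image of `X` under the homomorphism from the enveloping algebra
of `gl_n` to `S(n,d)`. -/
def act (n d : ℕ) (X : Matrix (Fin n) (Fin n) ℚ) : S n d :=
  ⟨∑ k, actAt n d X k, by
    rw [schurAlgebra, Subalgebra.mem_centralizer_iff]
    rintro _ ⟨σ, rfl⟩
    rw [Finset.mul_sum, Finset.sum_mul]
    simp only [placePerm_mul_actAt]
    exact Equiv.sum_comp σ (fun k => actAt n d X k * placePerm ℚ n d σ)⟩

/-- The root vector of the root `ε_i - ε_j`, that is, the matrix unit `E_ij`, in `S(n,d)`. -/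
def x (n d : ℕ) (i j : Fin n) : S n d := act n d (Matrix.single i j 1)

/-- The element `H_k`, the image of the diagonal matrix unit `E_kk`. -/
def H (n d : ℕ) (k : Fin n) : S n d := act n d (Matrix.single k k 1)

/-- The divided power `y ^ m / m!`. -/
def divPow {n d : ℕ} (y : S n d) (m : ℕ) : S n d := ((m ! : ℚ)⁻¹) • y ^ m

/-- The binomial coefficient `y (y - 1) ⋯ (y - m + 1) / m!`. -/
def binom {n d : ℕ} (y : S n d) (m : ℕ) : S n d :=
  ((m ! : ℚ)⁻¹) • Polynomial.aeval y (descPochhammer ℚ m)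

/-- The generator `e_j`, attached to the simple root `ε_j - ε_{j+1}`. -/
def e (n d : ℕ) (j : Fin (n - 1)) : S n d :=
  x n d ⟨j.1, by have := j.2; omega⟩ ⟨j.1 + 1, by have := j.2; omega⟩

/-- The generator `f_j`, attached to the root `ε_{j+1} - ε_j`. -/
def f (n d : ℕ) (j : Fin (n - 1)) : S n d :=
  x n d ⟨j.1 + 1, by have := j.2; omega⟩ ⟨j.1, by have := j.2; omega⟩

/-- The `n`-part compositions of `d` (zero parts are allowed). -/
abbrev Comp (n d : ℕ) : Type := {μ : Fin n → ℕ // ∑ k, μ k = d}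

/-- The idempotent `1_μ`, the product of the binomial coefficients `H_k choose μ_k`. (The elements
`H_k` commute with each other.) -/
def idem {n d : ℕ} (μ : Comp n d) : S n d :=
  (List.ofFn fun k : Fin n => binom (H n d k) (μ.1 k)).prod

/-- The positive roots: the pair `(i, j)` with `i < j` stands for `ε_i - ε_j`. -/
abbrev PosRoot (n : ℕ) : Type := {p : Fin n × Fin n // p.1 < p.2}

/-- The factors of Kostant monomials: divided powers of root vectors, and binomial coefficients
of the `H_k`. -/
inductive KostantFactor (n : ℕ) : Type
  | root (i j : Fin n) (hij : i ≠ j) (m : ℕ) : KostantFactor n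
  | cartan (k : Fin n) (m : ℕ) : KostantFactor n

/-- A Kostant monomial, as a formal product of factors in a given order. -/
abbrev KostantMonomial (n : ℕ) : Type := List (KostantFactor n)

/-- The value of a factor in `S(n,d)`. -/
def KostantFactor.val {n : ℕ} (d : ℕ) : KostantFactor n → S n d
  | .root i j _ m => divPow (x n d i j) m
  | .cartan k m => binom (H n d k) m

/-- The value of a Kostant monomial in `S(n,d)`. -/
def KostantMonomial.val {n : ℕ} (d : ℕ) (M : KostantMonomial n) : S n d :=
  (M.map (KostantFactor.val d)).prod

/-- The content of a factor, `m ε_{max(i,j)}` for a divided power of a root vector. -/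
def KostantFactor.content {n : ℕ} : KostantFactor n → (Fin n → ℕ)
  | .root i j _ m => Pi.single (max i j) m
  | .cartan _ _ => 0

/-- The content of a Kostant monomial. -/
def KostantMonomial.content {n : ℕ} (M : KostantMonomial n) : Fin n → ℕ :=
  (M.map KostantFactor.content).sum

/-- The opposite content of a factor, `m ε_{min(i,j)}` for a divided power of a root vector. It is
obtained from the content by reversing the order of the indices. -/
def KostantFactor.oppContent {n : ℕ} : KostantFactor n → (Fin n → ℕ)
  | .root i j _ m => Pi.single (min i j) m
  | .cartan _ _ => 0

/-- The opposite content of a Kostant monomial. -/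
def KostantMonomial.oppContent {n : ℕ} (M : KostantMonomial n) : Fin n → ℕ :=
  (M.map KostantFactor.oppContent).sum

/-- The Kostant monomial `e_A`, the product of the divided powers of the positive root vectors
with exponents `A`, taken in the order of the list `L`. -/
def eMon {n : ℕ} (L : List (PosRoot n)) (A : PosRoot n → ℕ) : KostantMonomial n :=
  L.map fun α => .root α.1.1 α.1.2 (ne_of_lt α.2) (A α)

/-- The Kostant monomial `f_C`, the product of the divided powers of the negative root vectors;
the exponent of the vector of `-α` is `C α`. The negative roots `-α` are taken in the order in which
the positive roots `α` stand in the list `L`. -/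
def fMon {n : ℕ} (L : List (PosRoot n)) (C : PosRoot n → ℕ) : KostantMonomial n :=
  L.map fun α => .root α.1.2 α.1.1 (ne_of_gt α.2) (C α)

end

end Schur

namespace Schur

noncomputable section

/-! In the standard basis, an element of `S n d` is a matrix indexed by pairs `(r, s)` of
multi-indices and constant on the orbits of simultaneous place permutations. It is integral exactly
when its entries are integers (`mem_integralSchur_iff`). An orbit is determined by its counts: how
often each pair `(i, j)` occurs among the `(r l, s l)`.

Filter entries by Hamming distance. The divided power of `x_ij` with exponent `m` has entry `1`
where `r` and `s` differ at exactly `m` places, always by the pair `(i, j)`, and `0` elsewhere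
(`mat_divPow`); `1_λ` is the diagonal indicator of weight `λ` (`mat_idem`). At the top distance of a
product `e_A 1_λ f_C`, only geodesics `r → t → s` contribute. The disjoint supports of `A` and `C`
then force the off-diagonal counts and the midpoint: `t l = max (r l) (s l)` (`min` for the opposite
order). So the entry is `1` if the counts are `A`, `C` and `t` has weight `λ`, and `0` otherwise
(`mat_monomial`). The weight of `t` is the content plus the diagonal counts (`wt_mid`), so the
condition content `⪯ λ` says precisely that the diagonal counts are nonnegative. Admissible
monomials thus biject with orbits and are unitriangular against them, hence form a basis
(`exists_basis_of_leading`).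

For generation, it remains to obtain all root divided powers and all `1_λ` from the simple ones. A
Heisenberg-type commutation formula isolates the divided powers of a commutator
(`dpow_mem_of_comm`), giving the non-simple roots. Kostant's `sl_2` formula isolates binomials in
`H_i - H_j` (`map_chooseFun_mem`); products of these cut out single values of consecutive weight
differences, which determine a weight because its total is `d`. -/

/-! ### Matrix coordinates and integrality -/

/-- The standard basis of the tensor power, indexed by multi-indices. -/
def tensorBasis (R : Type) [CommRing R] (n d : ℕ) :
    Module.Basis (Fin d → Fin n) R (TensorSpace R n d) :=
  Basis.piTensorProduct fun _ : Fin d => Pi.basisFun R (Fin n)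

theorem tensorBasis_apply (R : Type) [CommRing R] (n d : ℕ) (s : Fin d → Fin n) :
    tensorBasis R n d s = PiTensorProduct.tprod R fun l => (Pi.single (s l) 1 : Fin n → R) := by
  simp [tensorBasis]

@[elab_as_elim]
theorem tensorBasis_induction {R : Type} [CommRing R] {n d : ℕ} {P : TensorSpace R n d → Prop}
    (zero : P 0) (add : ∀ x y, P x → P y → P (x + y)) (smul : ∀ (c : R) x, P x → P (c • x))
    (basis : ∀ s, P (tensorBasis R n d s)) (v : TensorSpace R n d) : P v := by
  induction (tensorBasis R n d).mem_span v using Submodule.span_induction with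
  | mem x hx => obtain ⟨s, rfl⟩ := hx; exact basis s
  | zero => exact zero
  | add x y _ _ hx hy => exact add x y hx hy
  | smul c x _ hx => exact smul c x hx

theorem placePerm_tensorBasis (R : Type) [CommRing R] (n d : ℕ) (σ : Equiv.Perm (Fin d))
    (s : Fin d → Fin n) :
    placePerm R n d σ (tensorBasis R n d s) = tensorBasis R n d (s ∘ σ.symm) := by
  rw [tensorBasis_apply, tensorBasis_apply]
  exact PiTensorProduct.reindex_tprod (s := fun _ : Fin d => (Fin n → R)) σ _

/-- The matrix of an element of the Schur algebra in the standard basis. -/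
def mat (n d : ℕ) : S n d →ₐ[ℚ] Matrix (Fin d → Fin n) (Fin d → Fin n) ℚ :=
  (LinearMap.toMatrixAlgEquiv (tensorBasis ℚ n d)).toAlgHom.comp (schurAlgebra ℚ n d).val

theorem mat_apply {n d : ℕ} (T : S n d) (r s : Fin d → Fin n) :
    mat n d T r s = (tensorBasis ℚ n d).repr
      ((T : Module.End ℚ (TensorSpace ℚ n d)) (tensorBasis ℚ n d s)) r :=
  LinearMap.toMatrixAlgEquiv_apply _ _ _ _

theorem mat_injective (n d : ℕ) : Function.Injective (mat n d) :=
  (LinearMap.toMatrixAlgEquiv (tensorBasis ℚ n d)).injective.comp Subtype.val_injective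

theorem repr_placePerm (R : Type) [CommRing R] (n d : ℕ) (σ : Equiv.Perm (Fin d))
    (v : TensorSpace R n d) (r : Fin d → Fin n) :
    (tensorBasis R n d).repr (placePerm R n d σ v) r = (tensorBasis R n d).repr v (r ∘ σ) := by
  induction v using tensorBasis_induction with
  | zero => simp
  | add x y hx hy => simp [hx, hy]
  | smul c x hx => simp [hx]
  | basis s =>
    rw [placePerm_tensorBasis, Module.Basis.repr_self, Module.Basis.repr_self,
      Finsupp.single_apply, Finsupp.single_apply]
    congr 1
    rw [Equiv.comp_symm_eq]

theorem mat_comp_perm {n d : ℕ} (T : S n d) (σ : Equiv.Perm (Fin d)) (r s : Fin d → Fin n) :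
    mat n d T (r ∘ σ) (s ∘ σ) = mat n d T r s := by
  have h := (Subalgebra.mem_centralizer_iff ℚ).1 T.2 _ (Set.mem_range_self σ)
  have h2 := LinearMap.congr_fun h (tensorBasis ℚ n d (s ∘ σ))
  simp only [Module.End.mul_apply, placePerm_tensorBasis] at h2
  rw [mat_apply, mat_apply, ← repr_placePerm, h2]
  congr 4
  funext l; simp

theorem mat_x {n d : ℕ} (i j : Fin n) (r s : Fin d → Fin n) :
    mat n d (x n d i j) r s =
      ∑ k, if r k = i ∧ s = Function.update r k j then 1 else 0 := by
  rw [mat_apply, x, act]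
  simp only [LinearMap.sum_apply, map_sum, Finsupp.coe_finsetSum, Finset.sum_apply]
  refine Finset.sum_congr rfl fun k _ => ?_
  rw [tensorBasis_apply, actAt_tprod, tensorBasis, Basis.piTensorProduct_repr_tprod_apply]
  have : ∀ l, (Pi.basisFun ℚ (Fin n)).repr (if l = k then
      Matrix.toLin' (Matrix.single i j 1) (Pi.single (s l) 1) else Pi.single (s l) 1) (r l)
      = if (if l = k then r l = i ∧ s l = j else s l = r l) then 1 else 0 := by
    intro l
    split_ifs with h1
    all_goals simp_all [Matrix.toLin'_apply, eq_comm]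
  simp only [this]
  rw [Fintype.prod_ite_zero]
  simp only [Finset.prod_const_one]
  congr 1
  rw [eq_iff_iff]
  constructor
  · intro h
    have hk := h k
    rw [if_pos rfl] at hk
    refine ⟨hk.1, funext fun l => ?_⟩
    have hl := h l
    by_cases hlk : l = k
    · subst hlk; simp [hk.2]
    · rw [if_neg hlk] at hl; simp [hlk, hl]
  · rintro ⟨h, rfl⟩ l
    by_cases hlk : l = k
    · subst hlk; simp [h]
    · simp [hlk]

theorem tensorIncl_tensorBasis (n d : ℕ) (s : Fin d → Fin n) :
    tensorIncl n d (tensorBasis ℤ n d s) = tensorBasis ℚ n d s := by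
  rw [tensorBasis_apply, tensorBasis_apply, tensorIncl, PiTensorProduct.lift.tprod]
  simp only [MultilinearMap.compLinearMap_apply, MultilinearMap.coe_restrictScalars]
  congr 1
  funext l i
  simp [latticeIncl, Pi.single_apply]

theorem repr_tensorIncl (n d : ℕ) (v : TensorSpace ℤ n d) (r : Fin d → Fin n) :
    (tensorBasis ℚ n d).repr (tensorIncl n d v) r = ((tensorBasis ℤ n d).repr v r : ℚ) := by
  induction v using tensorBasis_induction with
  | zero => simp
  | add x y hx hy => simp [hx, hy]
  | smul c x hx =>
    rw [LinearMap.map_smul, ← Int.cast_smul_eq_zsmul ℚ, LinearEquiv.map_smul, LinearEquiv.map_smul,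
      Finsupp.smul_apply, Finsupp.smul_apply, hx, smul_eq_mul, smul_eq_mul, Int.cast_mul]
  | basis s =>
    rw [tensorIncl_tensorBasis, Module.Basis.repr_self, Module.Basis.repr_self,
      Finsupp.single_apply, Finsupp.single_apply]
    split_ifs <;> simp

theorem tensorIncl_injective (n d : ℕ) : Function.Injective (tensorIncl n d) := by
  intro v w h
  refine (tensorBasis ℤ n d).ext_elem fun r => ?_
  have := congr_arg (fun u => (tensorBasis ℚ n d).repr u r) h
  simpa [repr_tensorIncl] using this

theorem tensorIncl_placePerm (n d : ℕ) (σ : Equiv.Perm (Fin d)) (v : TensorSpace ℤ n d) :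
    tensorIncl n d (placePerm ℤ n d σ v) = placePerm ℚ n d σ (tensorIncl n d v) := by
  refine (tensorBasis ℚ n d).ext_elem fun r => ?_
  rw [repr_tensorIncl, repr_placePerm, repr_placePerm, repr_tensorIncl]

/-- An integer matrix defines an endomorphism of the lattice; it commutes with place permutations
because `T` does and `tensorIncl` is injective and equivariant. -/
theorem mem_integralSchur_iff {n d : ℕ} (T : S n d) :
    T ∈ integralSchur n d ↔ ∀ r s, ∃ z : ℤ, mat n d T r s = z := by
  constructor
  · rintro ⟨T₀, h⟩ r s
    rw [mat_apply, ← tensorIncl_tensorBasis, h, repr_tensorIncl]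
    exact ⟨_, rfl⟩
  · intro h
    choose z hz using h
    set T₀ : Module.End ℤ (TensorSpace ℤ n d) :=
      Matrix.toLinAlgEquiv (tensorBasis ℤ n d) (Matrix.of z) with hT₀
    have key : ∀ v, (T : Module.End ℚ (TensorSpace ℚ n d)) (tensorIncl n d v) =
        tensorIncl n d (T₀ v) := by
      intro v
      induction v using tensorBasis_induction with
      | zero => simp
      | add x y hx hy => simp [hx, hy]
      | smul c x hx =>
        rw [LinearMap.map_smul, LinearMap.map_smul, LinearMap.map_smul, ← hx, map_zsmul]
      | basis s =>
        refine (tensorBasis ℚ n d).ext_elem fun r => ?_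
        rw [tensorIncl_tensorBasis, ← mat_apply, hz, repr_tensorIncl, hT₀,
          ← LinearMap.toMatrixAlgEquiv_apply, LinearMap.toMatrixAlgEquiv_toLinAlgEquiv]
        rfl
    refine ⟨⟨T₀, ?_⟩, key⟩
    rw [schurAlgebra, Subalgebra.mem_centralizer_iff]
    rintro _ ⟨σ, rfl⟩
    refine LinearMap.ext fun v => tensorIncl_injective n d ?_
    simp only [Module.End.mul_apply]
    rw [tensorIncl_placePerm, ← key, ← key, tensorIncl_placePerm]
    exact LinearMap.congr_fun
      ((Subalgebra.mem_centralizer_iff ℚ).1 T.2 _ (Set.mem_range_self σ)) _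

/-! ### Entries of divided powers and weight idempotents -/

/-- The off-diagonal part of the matrix counting the pairs of entries of two multi-indices. -/
def off {n d : ℕ} (r s : Fin d → Fin n) (p : Fin n × Fin n) : ℕ :=
  (Finset.univ.filter fun l => r l ≠ s l ∧ (r l, s l) = p).card

theorem sum_off {n d : ℕ} (r s : Fin d → Fin n) : ∑ p, off r s p = hammingDist r s := by
  rw [hammingDist, Finset.card_eq_sum_card_fiberwise (f := fun l => (r l, s l))
    (t := Finset.univ) (fun _ _ => Finset.mem_coe.2 (Finset.mem_univ _))]
  simp only [off, Finset.filter_filter]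

theorem off_pos {n d : ℕ} {r s : Fin d → Fin n} {l : Fin d} (h : r l ≠ s l) :
    0 < off r s (r l, s l) :=
  Finset.card_pos.2 ⟨l, by simp [h]⟩

theorem off_eq_zero_iff {n d : ℕ} {r s : Fin d → Fin n} : off r s = 0 ↔ r = s := by
  constructor
  · intro h
    by_contra hne
    obtain ⟨l, hl⟩ := Function.ne_iff.1 hne
    have := off_pos hl
    simp [h] at this
  · rintro rfl
    funext p
    simp [off]

theorem off_eq_single_iff {n d : ℕ} {r s : Fin d → Fin n} {p : Fin n × Fin n} {m : ℕ} :
    off r s = Pi.single p m ↔ hammingDist r s = m ∧ ∀ l, r l ≠ s l → (r l, s l) = p := by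
  constructor
  · intro h
    refine ⟨by rw [← sum_off, h]; simp, fun l hl => ?_⟩
    by_contra hne
    have := off_pos hl
    rw [h, Pi.single_eq_of_ne hne] at this
    exact lt_irrefl _ this
  · rintro ⟨rfl, h⟩
    funext q
    by_cases hq : q = p
    · subst hq
      rw [Pi.single_eq_same, off, hammingDist]
      congr 1
      ext l
      simpa using h l
    · rw [Pi.single_eq_of_ne hq, off, Finset.card_eq_zero, Finset.filter_eq_empty_iff]
      rintro l - ⟨h1, h2⟩
      exact hq (h2.symm.trans (h l h1))

theorem hammingDist_update_of_ne {n d : ℕ} {r s : Fin d → Fin n} {k : Fin d} (h : r k ≠ s k) :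
    hammingDist (Function.update r k (s k)) s + 1 = hammingDist r s := by
  have : (Finset.univ.filter fun l => Function.update r k (s k) l ≠ s l) =
      (Finset.univ.filter fun l => r l ≠ s l).erase k := by
    ext l
    by_cases hl : l = k
    · subst hl; simp
    · simp [hl]
  rw [hammingDist, this, Finset.card_erase_add_one (by simpa using h), hammingDist]

theorem divPow_zero {n d : ℕ} (y : S n d) : divPow y 0 = 1 := by simp [divPow]

theorem succ_smul_divPow_succ {n d : ℕ} (y : S n d) (m : ℕ) :
    ((m : ℚ) + 1) • divPow y (m + 1) = y * divPow y m := by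
  rw [divPow, divPow, smul_smul, mul_smul_comm, ← pow_succ', Nat.factorial_succ]
  congr 1
  have : (m ! : ℚ) ≠ 0 := by positivity
  have : (m : ℚ) + 1 ≠ 0 := by positivity
  push_cast
  field_simp

theorem off_update_iff {n d : ℕ} {i j : Fin n} (hij : i ≠ j) (r s : Fin d → Fin n) (k : Fin d)
    (m : ℕ) : (r k = i ∧ off (Function.update r k j) s = Pi.single (i, j) m) ↔
      r k ≠ s k ∧ off r s = Pi.single (i, j) (m + 1) := by
  constructor
  · rintro ⟨hk, h⟩
    rw [off_eq_single_iff] at h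
    have hs : s k = j := by
      by_contra hne
      have := h.2 k (by simpa using fun h => hne h.symm)
      simp only [Function.update_self, Prod.mk.injEq] at this
      exact hij this.1.symm
    have hrs : r k ≠ s k := by rw [hk, hs]; exact hij
    refine ⟨hrs, off_eq_single_iff.2 ⟨?_, fun l hl => ?_⟩⟩
    · rw [← hammingDist_update_of_ne hrs, hs, h.1]
    · by_cases hlk : l = k
      · subst hlk; rw [hk, hs]
      · simpa [hlk, hl] using h.2 l
  · rintro ⟨hk, h⟩
    rw [off_eq_single_iff] at h
    have h2 := h.2 k hk
    simp only [Prod.mk.injEq] at h2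
    refine ⟨h2.1, off_eq_single_iff.2 ⟨?_, fun l hl => ?_⟩⟩
    · have := hammingDist_update_of_ne hk
      rw [h2.2] at this
      omega
    · by_cases hlk : l = k
      · subst hlk; simp [h2.2] at hl
      · simp only [Function.update_of_ne hlk] at hl ⊢
        exact h.2 l hl

/-- Induction through `(m + 1) y^(m+1) = y · y^(m)`: the first factor changes one of the differing
places, and the `m + 1` choices of that place cancel the scalar. -/
theorem mat_divPow {n d : ℕ} {i j : Fin n} (hij : i ≠ j) (m : ℕ) (r s : Fin d → Fin n) :
    mat n d (divPow (x n d i j) m) r s = if off r s = Pi.single (i, j) m then 1 else 0 := by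
  induction m generalizing r with
  | zero => simp [divPow_zero, Matrix.one_apply, off_eq_zero_iff]
  | succ m ih =>
    have hm : (m : ℚ) + 1 ≠ 0 := by positivity
    have h := congr_arg (fun T => mat n d T r s)
      (succ_smul_divPow_succ (x n d i j) m)
    simp only [map_smul, map_mul, Matrix.smul_apply, smul_eq_mul, Matrix.mul_apply, mat_x, ih,
      Finset.sum_mul] at h
    rw [Finset.sum_comm] at h
    have h2 : ∀ k : Fin d, ∑ t, (if r k = i ∧ t = Function.update r k j then (1 : ℚ) else 0) *
        (if off t s = Pi.single (i, j) m then 1 else 0) =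
        if r k ≠ s k ∧ off r s = Pi.single (i, j) (m + 1) then 1 else 0 := by
      intro k
      -- Once the place `k` is chosen, the intermediate multi-index is forced.
      rw [Finset.sum_eq_single (Function.update r k j)]
      · simp only [← off_update_iff hij, ite_and, and_true, ite_mul, one_mul, zero_mul]
      · intro t _ ht; simp [ht]
      · simp
    simp only [h2] at h
    apply mul_left_cancel₀ hm
    rw [h]
    split_ifs with h3
    · have := (off_eq_single_iff.1 h3).1
      simp only [h3, and_true, Finset.sum_boole, mul_one]
      rw [hammingDist] at this
      rw [this]; push_cast; rfl
    · simp [h3]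

/-- The weight of a multi-index: the number of occurrences of each value. -/
def wt {n d : ℕ} (s : Fin d → Fin n) (k : Fin n) : ℕ :=
  (Finset.univ.filter fun l => s l = k).card

theorem sum_wt {n d : ℕ} (s : Fin d → Fin n) : ∑ k, wt s k = d := by
  simp only [wt]
  rw [← Finset.card_eq_sum_card_fiberwise (f := s) (s := Finset.univ)
    (t := Finset.univ) (fun _ _ => Finset.mem_coe.2 (Finset.mem_univ _))]
  simp

theorem mat_H {n d : ℕ} (k : Fin n) :
    mat n d (H n d k) = Matrix.diagonal fun s => (wt s k : ℚ) := by
  ext r s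
  have := mat_x (d := d) k k r s
  rw [x] at this
  rw [H, this, Matrix.diagonal_apply]
  split_ifs with h
  · subst h
    rw [wt, Finset.card_filter]
    push_cast
    refine Finset.sum_congr rfl fun l _ => ?_
    by_cases hl : r l = k
    · subst hl; simp
    · simp [hl]
  · refine Finset.sum_eq_zero fun l _ => if_neg ?_
    rintro ⟨rfl, rfl⟩
    simp at h

theorem mat_binom_H {n d : ℕ} (k : Fin n) (m : ℕ) :
    mat n d (binom (H n d k) m) = Matrix.diagonal fun s => ((wt s k).choose m : ℚ) := by
  have h := Polynomial.aeval_algHom_apply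
    (Matrix.diagonalAlgHom ℚ : ((Fin d → Fin n) → ℚ) →ₐ[ℚ] _) (fun s => (wt s k : ℚ))
    (descPochhammer ℚ m)
  rw [binom, map_smul, ← Polynomial.aeval_algHom_apply, mat_H]
  rw [Matrix.diagonalAlgHom_apply, Matrix.diagonalAlgHom_apply] at h
  rw [h, ← Matrix.diagonal_smul]
  congr 1
  funext s
  rw [Pi.smul_apply, Polynomial.aeval_fn_apply, Polynomial.coe_aeval_eq_eval,
    descPochhammer_eval_eq_descFactorial, Nat.descFactorial_eq_factorial_mul_choose]
  have : (m ! : ℚ) ≠ 0 := by positivity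
  push_cast
  rw [smul_eq_mul, inv_mul_cancel_left₀ this]

theorem mat_idem {n d : ℕ} (μ : Comp n d) :
    mat n d (idem μ) = Matrix.diagonal fun s => if wt s = μ.1 then (1 : ℚ) else 0 := by
  have h : mat n d (idem μ) = Matrix.diagonalAlgHom ℚ
      (∏ k, fun s : Fin d → Fin n => ((wt s k).choose (μ.1 k) : ℚ)) := by
    rw [idem, map_list_prod, List.map_ofFn, ← List.prod_ofFn, map_list_prod, List.map_ofFn]
    congr 2
    funext k
    simp [mat_binom_H]
  rw [h, Matrix.diagonalAlgHom_apply]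
  congr 1
  funext s
  rw [Finset.prod_apply]
  split_ifs with hs
  · simp [hs]
  -- Both weights sum to `d`, so distinct weights leave some `k` where the binomial coefficient
  -- vanishes.
  · have : ∃ k, wt s k < μ.1 k := by
      by_contra! hle
      refine hs (funext fun k => ?_)
      have := (Finset.sum_eq_sum_iff_of_le (s := Finset.univ) fun k _ => hle k).1
        (by rw [sum_wt, μ.2])
      exact (this k (Finset.mem_univ k)).symm
    obtain ⟨k, hk⟩ := this
    exact Finset.prod_eq_zero (Finset.mem_univ k) (by simp [Nat.choose_eq_zero_of_lt hk])

theorem divPow_mem_integralSchur {n d : ℕ} {i j : Fin n} (hij : i ≠ j) (m : ℕ) :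
    divPow (x n d i j) m ∈ integralSchur n d := by
  rw [mem_integralSchur_iff]
  intro r s
  rw [mat_divPow hij]
  exact ⟨if off r s = Pi.single (i, j) m then 1 else 0, by split_ifs <;> simp⟩

theorem idem_mem_integralSchur {n d : ℕ} (μ : Comp n d) : idem μ ∈ integralSchur n d := by
  rw [mem_integralSchur_iff]
  intro r s
  rw [mat_idem, Matrix.diagonal_apply]
  exact ⟨if r = s then if wt r = μ.1 then 1 else 0 else 0, by split_ifs <;> simp⟩

/-! ### Leading terms with respect to the Hamming distance -/

/-- `X` has leading term `m`: among its entries at pairs of multi-indices of Hamming distance at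
least `∑ m`, those whose off-diagonal counts are given by `m` are `1` and the others vanish. -/
def Leads {n d : ℕ} (X : Matrix (Fin d → Fin n) (Fin d → Fin n) ℚ) (m : Fin n × Fin n → ℕ) :
    Prop :=
  ∀ r s, ∑ p, m p ≤ hammingDist r s → X r s = if off r s = m then 1 else 0

theorem Leads.apply_eq_zero {n d : ℕ} {X : Matrix (Fin d → Fin n) (Fin d → Fin n) ℚ}
    {m : Fin n × Fin n → ℕ} (h : Leads X m) {r s : Fin d → Fin n}
    (hlt : ∑ p, m p < hammingDist r s) : X r s = 0 := by
  rw [h r s hlt.le, if_neg]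
  rintro rfl
  rw [sum_off] at hlt
  exact lt_irrefl _ hlt

/-- The multi-index that agrees with `r` at the places where the pair of entries of `r` and `s`
lies in the support of `m`, and with `s` elsewhere. -/
def midIndex {n d : ℕ} (m : Fin n × Fin n → ℕ) (r s : Fin d → Fin n) (l : Fin d) : Fin n :=
  if m (r l, s l) ≠ 0 then r l else s l

/-- The Hamming triangle inequality is a sum of inequalities over places, so equality holds place by
place; a third value at some place would cost two changes instead of at most one. -/
theorem ite_ne_add_ite_ne_of_hammingDist_add_le {n d : ℕ} {r t s : Fin d → Fin n}
    (h : hammingDist r t + hammingDist t s ≤ hammingDist r s) (l : Fin d) :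
    t l = r l ∨ t l = s l := by
  have key : ∀ l ∈ Finset.univ, (if r l ≠ s l then 1 else 0) ≤
      (if r l ≠ t l then 1 else 0) + (if t l ≠ s l then 1 else 0) := by
    intro l _
    by_cases h1 : r l = t l <;> by_cases h2 : t l = s l <;> simp [h1, h2]
    split_ifs <;> omega
  have heq := (Finset.sum_eq_sum_iff_of_le key).1 (le_antisymm (Finset.sum_le_sum key) (by
    rw [Finset.sum_add_distrib]
    simpa only [hammingDist, Finset.card_filter] using h)) l (Finset.mem_univ l)
  by_contra! hne
  simp only [hne.1.symm, hne.2, ne_eq, not_false_iff, if_true] at heq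
  split_ifs at heq; omega

/-- The path `r → t → s` must be a geodesic, so each differing place changes in exactly one of the
two steps. Disjointness of the supports lets the pair `(r l, s l)` decide which step, so `t` is
unique. -/
theorem off_eq_and_off_eq_iff {n d : ℕ} {m m' : Fin n × Fin n → ℕ}
    (hdisj : ∀ p, m p = 0 ∨ m' p = 0) {r t s : Fin d → Fin n}
    (hle : ∑ p, m p + ∑ p, m' p ≤ hammingDist r s) :
    (off r t = m ∧ off t s = m') ↔ (off r s = m + m' ∧ t = midIndex m' r s) := by
  constructor
  · rintro ⟨rfl, rfl⟩
    rw [sum_off, sum_off] at hle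
    have ht := ite_ne_add_ite_ne_of_hammingDist_add_le hle
    constructor
    · funext p
      rw [Pi.add_apply, off, off, off, ← Finset.card_union_of_disjoint]
      · congr 1
        ext l
        simp only [Finset.mem_filter, Finset.mem_univ, true_and, Finset.mem_union]
        rcases ht l with h | h <;> rw [h] <;> simp
      · rw [Finset.disjoint_filter]
        rintro l - ⟨h1, -⟩ ⟨h2, -⟩
        rcases ht l with h | h
        · exact h1 h.symm
        · exact h2 h
    · funext l
      rw [midIndex]
      split_ifs with h
      · by_contra hne
        have hs : t l = s l := (ht l).resolve_left hne
        have h1 := off_pos (r := r) (s := t) (l := l) (Ne.symm hne)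
        rw [hs] at h1
        exact (hdisj (r l, s l)).elim h1.ne' h
      · by_contra hne
        have hr : t l = r l := (ht l).resolve_right hne
        have h1 := off_pos (r := t) (s := s) (l := l) hne
        rw [hr] at h1
        exact h h1.ne'
  · rintro ⟨h, rfl⟩
    have hp : ∀ p, off r s p = m p + m' p := fun p => by rw [h]; rfl
    -- The midpoint postpones the changes in the support of `m'` to the second step and makes all
    -- others in the first.
    have hsplit : ∀ p, off r (midIndex m' r s) p = (if m' p = 0 then off r s p else 0) ∧
        off (midIndex m' r s) s p = (if m' p = 0 then 0 else off r s p) := by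
      intro p
      constructor <;> split_ifs with h0
      · rw [off, off]
        congr 1
        ext l
        simp only [Finset.mem_filter, Finset.mem_univ, true_and]
        rw [midIndex]
        by_cases hl : m' (r l, s l) = 0
        · simp [hl]
        · simp only [hl, ne_eq, not_false_iff, if_true, not_true, false_and, false_iff]
          rintro ⟨-, rfl⟩
          exact hl h0
      · rw [off, Finset.card_eq_zero, Finset.filter_eq_empty_iff]
        rintro l - ⟨h1, rfl⟩
        rw [midIndex] at h1 h0
        by_cases hl : m' (r l, s l) = 0
        · simp [hl] at h0
        · simp [hl] at h1
      · rw [off, Finset.card_eq_zero, Finset.filter_eq_empty_iff]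
        rintro l - ⟨h1, rfl⟩
        rw [midIndex] at h1 h0
        by_cases hl : m' (r l, s l) = 0
        · simp [hl] at h1
        · simp [hl] at h0
      · rw [off, off]
        congr 1
        ext l
        simp only [Finset.mem_filter, Finset.mem_univ, true_and]
        rw [midIndex]
        by_cases hl : m' (r l, s l) = 0
        · simp only [hl, ne_eq, not_true, if_false, false_and, false_iff]
          rintro ⟨-, rfl⟩
          exact h0 hl
        · simp [hl]
    constructor <;> funext p
    · rw [(hsplit p).1, hp]
      rcases hdisj p with h1 | h1 <;> simp [h1]
    · rw [(hsplit p).2, hp]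
      rcases hdisj p with h1 | h1 <;> simp [h1]
      exact fun h => h.symm

/-- At this distance the triangle inequality leaves only intermediate indices at distances `∑ m` and
`∑ m'`: if the first step is shorter, the second is too long and its entry vanishes. The one
surviving midpoint picks out a value of `w`. -/
theorem Leads.mul_diagonal_mul {n d : ℕ} {X Y : Matrix (Fin d → Fin n) (Fin d → Fin n) ℚ}
    {m m' : Fin n × Fin n → ℕ} (hX : Leads X m) (hY : Leads Y m')
    (hdisj : ∀ p, m p = 0 ∨ m' p = 0) (w : (Fin d → Fin n) → ℚ) {r s : Fin d → Fin n}
    (hle : ∑ p, m p + ∑ p, m' p ≤ hammingDist r s) :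
    (X * Matrix.diagonal w * Y) r s =
      if off r s = m + m' then w (midIndex m' r s) else 0 := by
  have h : ∀ t, (X * Matrix.diagonal w) r t * Y t s =
      if off r s = m + m' ∧ t = midIndex m' r s then w t else 0 := by
    intro t
    rw [Matrix.mul_diagonal]
    have htri := hammingDist_triangle r t s
    simp only [← off_eq_and_off_eq_iff hdisj hle]
    by_cases h1 : ∑ p, m p ≤ hammingDist r t
    · rw [hX r t h1]
      by_cases h2 : off r t = m
      · have : hammingDist r t = ∑ p, m p := by rw [← h2, sum_off]
        rw [hY t s (by omega)]
        simp [h2]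
      · simp [h2]
    · rw [hY.apply_eq_zero (by omega), mul_zero, if_neg]
      rintro ⟨rfl, -⟩
      rw [sum_off] at h1
      exact h1 le_rfl
  rw [Matrix.mul_apply, Finset.sum_congr rfl fun t _ => h t]
  simp [ite_and]

theorem leads_one {n d : ℕ} :
    Leads (1 : Matrix (Fin d → Fin n) (Fin d → Fin n) ℚ) 0 := by
  intro r s _
  rw [Matrix.one_apply]
  simp only [off_eq_zero_iff]

theorem Leads.mul {n d : ℕ} {X Y : Matrix (Fin d → Fin n) (Fin d → Fin n) ℚ}
    {m m' : Fin n × Fin n → ℕ} (hX : Leads X m) (hY : Leads Y m')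
    (hdisj : ∀ p, m p = 0 ∨ m' p = 0) : Leads (X * Y) (m + m') := by
  intro r s h
  simpa using hX.mul_diagonal_mul hY hdisj 1 (r := r) (s := s)
    (by simpa [Finset.sum_add_distrib] using h)

theorem leads_divPow {n d : ℕ} {i j : Fin n} (hij : i ≠ j) (m : ℕ) :
    Leads (mat n d (divPow (x n d i j) m)) (Pi.single (i, j) m) :=
  fun r s _ => mat_divPow hij m r s

/-- The product of divided powers of root vectors along a list. -/
def rootProd {ι : Type*} {n : ℕ} (d : ℕ) (p : ι → Fin n × Fin n) (L : List ι) (A : ι → ℕ) :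
    S n d :=
  (L.map fun α => divPow (x n d (p α).1 (p α).2) (A α)).prod

theorem rootProd_mem {ι : Type*} {n d : ℕ} {p : ι → Fin n × Fin n} {R : Subring (S n d)}
    (h : ∀ α m, divPow (x n d (p α).1 (p α).2) m ∈ R) (L : List ι) (A : ι → ℕ) :
    rootProd d p L A ∈ R := by
  refine Subring.list_prod_mem _ fun y hy => ?_
  obtain ⟨α, -, rfl⟩ := List.mem_map.1 hy
  exact h α _

theorem leads_rootProd {ι : Type*} {n d : ℕ} {p : ι → Fin n × Fin n}
    (hinj : Function.Injective p) (hp : ∀ α, (p α).1 ≠ (p α).2) {L : List ι} (hL : L.Nodup)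
    (A : ι → ℕ) :
    Leads (mat n d (rootProd d p L A)) (L.map fun α => Pi.single (p α) (A α)).sum := by
  induction L with
  | nil => simpa [rootProd] using leads_one
  | cons α L ih =>
    rw [List.nodup_cons] at hL
    have h := (leads_divPow (d := d) (hp α) (A α)).mul (ih hL.2) (fun q => by
      by_cases hq : q = p α
      · right
        subst hq
        rw [Pi.list_sum_apply, List.map_map]
        refine List.sum_eq_zero fun y hy => ?_
        obtain ⟨β, hβ, rfl⟩ := List.mem_map.1 hy
        exact Pi.single_eq_of_ne (fun h => hL.1 (by rw [hinj h]; exact hβ)) _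
      · left
        exact Pi.single_eq_of_ne hq _)
    simpa [rootProd] using h

theorem sum_map_single {ι κ : Type*} [Fintype ι] [DecidableEq κ] {p : ι → κ} {L : List ι}
    (hL : L.Nodup) (hall : ∀ α, α ∈ L) (A : ι → ℕ) :
    (L.map fun α => Pi.single (M := fun _ => ℕ) (p α) (A α)).sum =
      ∑ α, Pi.single (p α) (A α) := by
  classical
  have : (Finset.univ : Finset ι) = L.toFinset := by ext; simp [hall]
  rw [this, List.sum_toFinset _ hL]

/-! ### Unitriangular families are bases -/

/-- A family of integral elements whose entries are unitriangular with respect to the Hamming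
distance is a basis of the integral Schur algebra. -/
theorem exists_basis_of_leading {n d : ℕ} {κ : Type} (b : κ → S n d)
    (hb : ∀ t, b t ∈ integralSchur n d) (τ : (Fin d → Fin n) → (Fin d → Fin n) → κ)
    (hsurj : ∀ t, ∃ r s, τ r s = t) (deg : κ → ℕ) (hdeg : ∀ r s, deg (τ r s) = hammingDist r s)
    (hperm : ∀ r s r' s', τ r s = τ r' s' → ∃ σ : Equiv.Perm (Fin d), r' = r ∘ σ ∧ s' = s ∘ σ)
    (hlead : ∀ t r s, deg t ≤ hammingDist r s → τ r s = t → mat n d (b t) r s = 1)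
    (hlead' : ∀ t r s, deg t ≤ hammingDist r s → τ r s ≠ t → mat n d (b t) r s = 0) :
    ∃ B : Module.Basis κ ℤ (integralSchur n d), ∀ t, (B t : S n d) = b t := by
  classical
  have : Finite κ := Finite.of_surjective
    (fun rs : (Fin d → Fin n) × (Fin d → Fin n) => τ rs.1 rs.2) fun t => by
      obtain ⟨r, s, h⟩ := hsurj t
      exact ⟨(r, s), h⟩
  have : Fintype κ := Fintype.ofFinite κ
  set b' : κ → integralSchur n d := fun t => ⟨b t, hb t⟩ with hb'
  have hmat : ∀ (u : Finset κ) (c : κ → ℤ) (r s : Fin d → Fin n),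
      mat n d ((∑ t ∈ u, c t • b' t : integralSchur n d) : S n d) r s =
        ∑ t ∈ u, (c t : ℚ) * mat n d (b t) r s := by
    intro u c r s
    rw [AddSubmonoidClass.coe_finsetSum, map_sum, Matrix.sum_apply]
    refine Finset.sum_congr rfl fun t _ => ?_
    rw [AddSubgroupClass.coe_zsmul, map_zsmul, Matrix.smul_apply, zsmul_eq_mul]
  have hli : LinearIndependent ℤ b' := by
    rw [Fintype.linearIndependent_iff]
    intro g hg
    by_contra! hne
    obtain ⟨t₀, ht₀⟩ := hne
    -- Evaluating a relation at an entry indexed by a term of maximal degree kills every other term.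
    obtain ⟨t, ht, hmax⟩ := Finset.exists_max_image (Finset.univ.filter fun t => g t ≠ 0) deg
      ⟨t₀, by simpa using ht₀⟩
    simp only [Finset.mem_filter, Finset.mem_univ, true_and] at ht hmax
    obtain ⟨r, s, rfl⟩ := hsurj t
    have h := hmat Finset.univ g r s
    rw [hg, Finset.sum_eq_single (τ r s), hlead _ r s (hdeg r s).le rfl] at h
    · simp only [ZeroMemClass.coe_zero, map_zero, Matrix.zero_apply, mul_one] at h
      exact ht (by exact_mod_cast h.symm)
    · intro t' _ ht'
      by_cases h0 : g t' = 0
      · simp [h0]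
      · rw [hlead' t' r s ((hmax t' h0).trans (hdeg r s).le) ht'.symm, mul_zero]
    · simp
  -- Elimination from the top: subtracting a combination of the degree-`N` elements clears the
  -- entries at distance `N` without disturbing the zeros beyond it.
  have hspan : ∀ N, ∀ T : integralSchur n d,
      (∀ r s, N ≤ hammingDist r s → mat n d (T : S n d) r s = 0) →
      T ∈ Submodule.span ℤ (Set.range b') := by
    intro N
    induction N with
    | zero =>
      intro T hT
      have : T = 0 := Subtype.ext (mat_injective n d (by
        ext r s
        simpa using hT r s (Nat.zero_le _)))
      rw [this]
      exact Submodule.zero_mem _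
    | succ N ih =>
      intro T hT
      choose ρ ρ' hρ using hsurj
      choose z hz using (mem_integralSchur_iff (T : S n d)).1 T.2
      set U : integralSchur n d :=
        ∑ t ∈ Finset.univ.filter (fun t => deg t = N), z (ρ t) (ρ' t) • b' t with hU
      have hUmem : U ∈ Submodule.span ℤ (Set.range b') :=
        Submodule.sum_mem _ fun t _ => Submodule.smul_mem _ _ (Submodule.subset_span ⟨t, rfl⟩)
      have key : T - U ∈ Submodule.span ℤ (Set.range b') := by
        refine ih _ fun r s hrs => ?_
        rw [AddSubgroupClass.coe_sub, map_sub, Matrix.sub_apply, hU, hmat, sub_eq_zero]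
        rcases hrs.eq_or_lt with hN | hN
        · rw [Finset.sum_eq_single (τ r s), hlead _ r s (hdeg r s).le rfl, mul_one, ← hz]
          -- The coefficient was read off at a chosen representative; permutation invariance carries
          -- it to `(r, s)`.
          · obtain ⟨σ, h1, h2⟩ := hperm r s _ _ (hρ (τ r s)).symm
            rw [h1, h2, mat_comp_perm]
          · intro t ht hne
            rw [hlead' t r s ((Finset.mem_filter.1 ht).2.le.trans hN.le) hne.symm, mul_zero]
          · intro h
            simp [hdeg, hN] at h
        · rw [hT r s hN, Finset.sum_eq_zero]
          intro t ht
          have ht := (Finset.mem_filter.1 ht).2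
          rw [hlead' t r s (by omega), mul_zero]
          rintro rfl
          rw [hdeg] at ht
          omega
      simpa using Submodule.add_mem _ key hUmem
  refine ⟨Module.Basis.mk hli fun T _ => hspan (d + 1) T fun r s h => ?_, fun t => ?_⟩
  · have := hammingDist_le_card_fintype (x := r) (y := s)
    rw [Fintype.card_fin] at this
    omega
  · rw [Module.Basis.mk_apply]

/-! ### Orbits of index pairs and admissible monomials -/

theorem exists_perm_of_card_fiber_eq {α κ : Type*} [Fintype α] [DecidableEq κ] {g g' : α → κ}
    (h : ∀ p, (Finset.univ.filter fun l => g l = p).card =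
      (Finset.univ.filter fun l => g' l = p).card) :
    ∃ σ : Equiv.Perm α, g' = g ∘ σ := by
  have e : ∀ p, Nonempty ({l // g' l = p} ≃ {l // g l = p}) := fun p =>
    Fintype.card_eq.1 (by rw [Fintype.card_subtype, Fintype.card_subtype, h])
  refine ⟨Equiv.ofFiberEquiv fun p => (e p).some, funext fun l => ?_⟩
  exact (Equiv.ofFiberEquiv_map _ l).symm

theorem exists_card_fiber_eq {κ : Type*} [Fintype κ] [DecidableEq κ] (M : κ → ℕ) (d : ℕ)
    (h : ∑ p, M p = d) :
    ∃ g : Fin d → κ, ∀ p, (Finset.univ.filter fun l => g l = p).card = M p := by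
  have e : Fin d ≃ Σ p, Fin (M p) := Fintype.equivOfCardEq (by simp [h])
  refine ⟨fun l => (e l).1, fun p => ?_⟩
  rw [← Fintype.card_subtype, ← Fintype.card_fin (M p)]
  refine Fintype.card_congr ((e.subtypeEquiv fun l => Iff.rfl).trans
    (Equiv.sigmaSubtype (β := fun p => Fin (M p)) p))

/-- Admissible data for the monomials `x_p^(A) 1_λ x_q^(C)`: two families of off-diagonal pairs
that cover each such pair once, and the index through which a pair of either family passes. -/
structure RootSplit (n : ℕ) (ι : Type) where
  p : ι → Fin n × Fin n
  q : ι → Fin n × Fin n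
  mid : Fin n × Fin n → Fin n
  bij : Function.Bijective (Sum.elim (Sum.elim p q) fun k : Fin n => (k, k))
  mid_diag : ∀ k, mid (k, k) = k
  mid_p : ∀ α, mid (p α) = (p α).2
  mid_q : ∀ α, mid (q α) = (q α).1

namespace RootSplit

variable {n : ℕ} {ι : Type} (D : RootSplit n ι)

theorem p_inj : Function.Injective D.p := fun a b h => by
  simpa using @D.bij.1 (Sum.inl (Sum.inl a)) (Sum.inl (Sum.inl b)) h

theorem q_inj : Function.Injective D.q := fun a b h => by
  simpa using @D.bij.1 (Sum.inl (Sum.inr a)) (Sum.inl (Sum.inr b)) h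

theorem p_ne_q (α β : ι) : D.p α ≠ D.q β := fun h => by
  simpa using @D.bij.1 (Sum.inl (Sum.inl α)) (Sum.inl (Sum.inr β)) h

theorem p_ne (α : ι) : (D.p α).1 ≠ (D.p α).2 := fun h => by
  simpa using @D.bij.1 (Sum.inl (Sum.inl α)) (Sum.inr (D.p α).1) (Prod.ext rfl h.symm)

theorem q_ne (α : ι) : (D.q α).1 ≠ (D.q α).2 := fun h => by
  simpa using @D.bij.1 (Sum.inl (Sum.inr α)) (Sum.inr (D.q α).1) (Prod.ext rfl h.symm)

theorem pair_cases (P : Fin n × Fin n) :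
    (∃ α, D.p α = P) ∨ (∃ α, D.q α = P) ∨ P.1 = P.2 := by
  obtain ⟨(α | α) | k, rfl⟩ := D.bij.2 P
  · exact Or.inl ⟨α, rfl⟩
  · exact Or.inr (Or.inl ⟨α, rfl⟩)
  · exact Or.inr (Or.inr rfl)

theorem sum_pairs [Fintype ι] {M : Type*} [AddCommMonoid M] (g : Fin n × Fin n → M) :
    ∑ P, g P = ∑ α, g (D.p α) + ∑ α, g (D.q α) + ∑ k, g (k, k) := by
  rw [← (Equiv.ofBijective _ D.bij).sum_comp]
  simp [Fintype.sum_sum_type]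

/-- The content of the exponents `A`, `C`. -/
def content [Fintype ι] (A C : ι → ℕ) : Fin n → ℕ :=
  ∑ α, Pi.single (D.mid (D.p α)) (A α) + ∑ α, Pi.single (D.mid (D.q α)) (C α)

theorem sum_content [Fintype ι] (A C : ι → ℕ) :
    ∑ k, D.content A C k = ∑ α, A α + ∑ α, C α := by
  simp only [content, Pi.add_apply, Finset.sum_apply, Finset.sum_add_distrib]
  congr 1 <;> rw [Finset.sum_comm] <;> simp

end RootSplit

/-- The number of places at which two multi-indices have a given pair of entries. -/
def cnt {n d : ℕ} (r s : Fin d → Fin n) (P : Fin n × Fin n) : ℕ :=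
  (Finset.univ.filter fun l => (r l, s l) = P).card

theorem off_eq_cnt {n d : ℕ} (r s : Fin d → Fin n) {P : Fin n × Fin n} (h : P.1 ≠ P.2) :
    off r s P = cnt r s P := by
  rw [off, cnt]
  congr 1
  ext l
  simp only [Finset.mem_filter, Finset.mem_univ, true_and, and_iff_right_iff_imp]
  rintro rfl
  exact h

theorem off_diag {n d : ℕ} (r s : Fin d → Fin n) {P : Fin n × Fin n} (h : P.1 = P.2) :
    off r s P = 0 := by
  rw [off, Finset.card_eq_zero, Finset.filter_eq_empty_iff]
  rintro l - ⟨h1, rfl⟩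
  exact h1 h

namespace RootSplit

variable {n : ℕ} {ι : Type} [Fintype ι] (D : RootSplit n ι)

/-- Group the places by their pair `(r l, s l)`: off-diagonal pairs contribute the content, and the
diagonal pair `(k, k)` contributes to `k` alone. This is where the content condition comes from. -/
theorem wt_mid {d : ℕ} (r s : Fin d → Fin n) (k : Fin n) :
    wt (fun l => D.mid (r l, s l)) k =
      D.content (fun α => cnt r s (D.p α)) (fun α => cnt r s (D.q α)) k + cnt r s (k, k) := by
  have h : wt (fun l => D.mid (r l, s l)) k = ∑ P, if k = D.mid P then cnt r s P else 0 := by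
    rw [wt, Finset.card_eq_sum_card_fiberwise (f := fun l => (r l, s l))
      (t := Finset.univ) (fun _ _ => Finset.mem_coe.2 (Finset.mem_univ _))]
    refine Finset.sum_congr rfl fun P _ => ?_
    rw [Finset.filter_filter]
    split_ifs with hP
    · rw [cnt]
      congr 1
      ext l
      simp only [Finset.mem_filter, Finset.mem_univ, true_and, and_iff_right_iff_imp]
      rintro rfl
      exact hP.symm
    · rw [Finset.card_eq_zero, Finset.filter_eq_empty_iff]
      rintro l - ⟨h1, rfl⟩
      exact hP h1.symm
  rw [h, D.sum_pairs]
  simp [content, Pi.single_apply, D.mid_diag]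

/-- The exponents and middle weights indexing the monomials `x_p^(A) 1_λ x_q^(C)`. -/
abbrev Index (d : ℕ) : Type :=
  {t : (ι → ℕ) × Comp n d × (ι → ℕ) // D.content t.1 t.2.2 ≤ t.2.1.1}

/-- The index of the monomial whose leading term is at the entry `(r, s)`. -/
def index {d : ℕ} (r s : Fin d → Fin n) : D.Index d :=
  ⟨(fun α => cnt r s (D.p α), ⟨wt fun l => D.mid (r l, s l), sum_wt _⟩,
    fun α => cnt r s (D.q α)), fun k => (Nat.le_add_right _ _).trans (D.wt_mid r s k).ge⟩

theorem index_eq_iff {d : ℕ} (r s : Fin d → Fin n) (t : D.Index d) :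
    D.index r s = t ↔ (∀ α, cnt r s (D.p α) = t.1.1 α) ∧ (∀ α, cnt r s (D.q α) = t.1.2.2 α) ∧
      wt (fun l => D.mid (r l, s l)) = t.1.2.1.1 := by
  obtain ⟨⟨A, ⟨μ, hμ⟩, C⟩, h⟩ := t
  simp only [index, Subtype.mk.injEq, Prod.mk.injEq, funext_iff]
  tauto

theorem exists_index_eq {d : ℕ} (t : D.Index d) : ∃ r s, D.index r s = t := by
  obtain ⟨⟨A, ⟨μ, hμ⟩, C⟩, h⟩ := t
  simp only at h
  -- The required counts: `A` and `C` off the diagonal, and on it the excess of `μ` over the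
  -- content, whose truncated subtraction is exact by `h`.
  set M : Fin n × Fin n → ℕ := fun P => Sum.elim (Sum.elim A C) (fun k => μ k - D.content A C k)
    ((Equiv.ofBijective _ D.bij).symm P) with hM
  have hval : ∀ u, M (Sum.elim (Sum.elim D.p D.q) (fun k : Fin n => (k, k)) u) =
      Sum.elim (Sum.elim A C) (fun k => μ k - D.content A C k) u := fun u => by
    rw [hM]
    exact congr_arg _ ((Equiv.ofBijective _ D.bij).symm_apply_apply u)
  have hp : ∀ α, M (D.p α) = A α := fun α => hval (Sum.inl (Sum.inl α))
  have hq : ∀ α, M (D.q α) = C α := fun α => hval (Sum.inl (Sum.inr α))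
  have hk : ∀ k, M (k, k) = μ k - D.content A C k := fun k => hval (Sum.inr k)
  obtain ⟨g, hg⟩ := exists_card_fiber_eq M d (by
    rw [D.sum_pairs]
    simp only [hp, hq, hk]
    rw [← D.sum_content, ← Finset.sum_add_distrib, ← hμ]
    exact Finset.sum_congr rfl fun k _ => Nat.add_sub_cancel' (h k))
  have hc : ∀ P, cnt (fun l => (g l).1) (fun l => (g l).2) P = M P := hg
  refine ⟨fun l => (g l).1, fun l => (g l).2, (D.index_eq_iff _ _ _).2
    ⟨fun α => by rw [hc, hp], fun α => by rw [hc, hq], funext fun k => ?_⟩⟩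
  rw [D.wt_mid]
  simp only [hc, hp, hq, hk]
  exact Nat.add_sub_cancel' (h k)

/-- The index records the off-diagonal counts; the diagonal ones are recovered by cancelling the
content in `wt_mid`. -/
theorem cnt_eq_of_index_eq {d : ℕ} {r s r' s' : Fin d → Fin n}
    (h : D.index r s = D.index r' s') (P : Fin n × Fin n) : cnt r s P = cnt r' s' P := by
  obtain ⟨h1, h2, h3⟩ := (D.index_eq_iff _ _ _).1 h
  rcases D.pair_cases P with ⟨α, rfl⟩ | ⟨α, rfl⟩ | hP
  · exact h1 α
  · exact h2 α
  · obtain ⟨i, j⟩ := P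
    simp only at hP
    subst hP
    have h4 := congr_fun h3 i
    simp only [index] at h1 h2 h4
    rw [D.wt_mid, D.wt_mid, funext h1, funext h2] at h4
    exact Nat.add_left_cancel h4

/-- The degree of an index: the total exponent of the root vectors. -/
def degree {d : ℕ} (t : D.Index d) : ℕ := ∑ α, t.1.1 α + ∑ α, t.1.2.2 α

theorem degree_index {d : ℕ} (r s : Fin d → Fin n) :
    D.degree (D.index r s) = hammingDist r s := by
  rw [← sum_off, D.sum_pairs]
  simp only [off_eq_cnt _ _ (D.p_ne _), off_eq_cnt _ _ (D.q_ne _),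
    off_diag (P := (_, _)) r s rfl, Finset.sum_const_zero, add_zero]
  rfl

/-- The monomial `x_p^(A) 1_λ x_q^(C)`. -/
def monomial (L L' : List ι) {d : ℕ} (t : D.Index d) : S n d :=
  rootProd d D.p L t.1.1 * idem t.1.2.1 * rootProd d D.q L' t.1.2.2

theorem mat_monomial {L L' : List ι} (hL : L.Nodup) (hL' : L'.Nodup) (hall : ∀ α, α ∈ L)
    (hall' : ∀ α, α ∈ L') {d : ℕ} (t : D.Index d) (r s : Fin d → Fin n)
    (hle : D.degree t ≤ hammingDist r s) [Decidable (D.index r s = t)] :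
    mat n d (D.monomial L L' t) r s = if D.index r s = t then 1 else 0 := by
  classical
  set m : Fin n × Fin n → ℕ := ∑ α, Pi.single (D.p α) (t.1.1 α) with hm
  set m' : Fin n × Fin n → ℕ := ∑ α, Pi.single (D.q α) (t.1.2.2 α) with hm'
  have h1 : Leads (mat n d (rootProd d D.p L t.1.1)) m := by
    rw [hm, ← sum_map_single hL hall]
    exact leads_rootProd D.p_inj D.p_ne hL t.1.1
  have h2 : Leads (mat n d (rootProd d D.q L' t.1.2.2)) m' := by
    rw [hm', ← sum_map_single hL' hall']
    exact leads_rootProd D.q_inj D.q_ne hL' t.1.2.2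
  have mp : ∀ α, m (D.p α) = t.1.1 α := fun α => by
    rw [hm, Finset.sum_apply, Finset.sum_eq_single α]
    · simp
    · intro β _ hβ; exact Pi.single_eq_of_ne (fun h => hβ (D.p_inj h.symm)) _
    · simp
  have mq : ∀ α, m (D.q α) = 0 := fun α => by
    rw [hm, Finset.sum_apply]
    exact Finset.sum_eq_zero fun β _ => Pi.single_eq_of_ne (D.p_ne_q β α).symm _
  have m'q : ∀ α, m' (D.q α) = t.1.2.2 α := fun α => by
    rw [hm', Finset.sum_apply, Finset.sum_eq_single α]
    · simp
    · intro β _ hβ; exact Pi.single_eq_of_ne (fun h => hβ (D.q_inj h.symm)) _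
    · simp
  have m'p : ∀ α, m' (D.p α) = 0 := fun α => by
    rw [hm', Finset.sum_apply]
    exact Finset.sum_eq_zero fun β _ => Pi.single_eq_of_ne (D.p_ne_q α β) _
  have md : ∀ P : Fin n × Fin n, P.1 = P.2 → m P = 0 ∧ m' P = 0 := by
    intro P hP
    rw [hm, hm', Finset.sum_apply, Finset.sum_apply]
    exact ⟨Finset.sum_eq_zero fun β _ =>
        Pi.single_eq_of_ne (fun h => D.p_ne β (by rw [← h, hP])) _,
      Finset.sum_eq_zero fun β _ => Pi.single_eq_of_ne (fun h => D.q_ne β (by rw [← h, hP])) _⟩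
  have hdisj : ∀ P, m P = 0 ∨ m' P = 0 := by
    intro P
    rcases D.pair_cases P with ⟨α, rfl⟩ | ⟨α, rfl⟩ | hP
    · exact Or.inr (m'p α)
    · exact Or.inl (mq α)
    · exact Or.inl (md P hP).1
  have hsum : ∑ P, m P + ∑ P, m' P = D.degree t := by
    rw [D.sum_pairs, D.sum_pairs]
    simp [mp, mq, m'q, m'p, fun k => (md (k, k) rfl).1, fun k => (md (k, k) rfl).2, degree]
  have hoff : off r s = m + m' ↔ (∀ α, cnt r s (D.p α) = t.1.1 α) ∧
      (∀ α, cnt r s (D.q α) = t.1.2.2 α) := by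
    constructor
    · intro h
      refine ⟨fun α => ?_, fun α => ?_⟩
      · rw [← off_eq_cnt r s (D.p_ne α), h, Pi.add_apply, mp, m'p, add_zero]
      · rw [← off_eq_cnt r s (D.q_ne α), h, Pi.add_apply, mq, m'q, zero_add]
    · rintro ⟨hp, hq⟩
      funext P
      rw [Pi.add_apply]
      rcases D.pair_cases P with ⟨α, rfl⟩ | ⟨α, rfl⟩ | hP
      · rw [off_eq_cnt r s (D.p_ne α), hp, mp, m'p, add_zero]
      · rw [off_eq_cnt r s (D.q_ne α), hq, mq, m'q, zero_add]
      · rw [off_diag r s hP, (md P hP).1, (md P hP).2]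
  rw [monomial, map_mul, map_mul, mat_idem, h1.mul_diagonal_mul h2 hdisj _ (hsum.trans_le hle)]
  simp only [D.index_eq_iff, ← ite_and, hoff, and_assoc]
  refine if_congr (and_congr_right fun hp => and_congr_right fun hq => ?_) rfl rfl
  have hmid : midIndex m' r s = fun l => D.mid (r l, s l) := by
    funext l
    rw [midIndex]
    rcases D.pair_cases (r l, s l) with ⟨α, hα⟩ | ⟨α, hα⟩ | hP
    · rw [← hα, m'p, D.mid_p, hα]; simp
    · have : r l ≠ s l := by
        have := D.q_ne α
        rwa [hα] at this
      have h3 := off_pos this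
      rw [off_eq_cnt r s this, ← hα, hq, ← m'q] at h3
      rw [← hα, D.mid_q, if_pos h3.ne', hα]
    · have hP : r l = s l := hP
      rw [hP, (md (s l, s l) rfl).2, D.mid_diag]; simp
  rw [hmid]

theorem monomial_mem (L L' : List ι) {d : ℕ} {R : Subring (S n d)}
    (hroot : ∀ i j, i ≠ j → ∀ m, divPow (x n d i j) m ∈ R) (hidem : ∀ μ : Comp n d, idem μ ∈ R)
    (t : D.Index d) : D.monomial L L' t ∈ R :=
  R.mul_mem (R.mul_mem (rootProd_mem (fun α m => hroot _ _ (D.p_ne α) m) _ _) (hidem _))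
    (rootProd_mem (fun α m => hroot _ _ (D.q_ne α) m) _ _)

theorem exists_basis {L L' : List ι} (hL : L.Nodup) (hL' : L'.Nodup) (hall : ∀ α, α ∈ L)
    (hall' : ∀ α, α ∈ L') (d : ℕ) :
    ∃ B : Module.Basis (D.Index d) ℤ (integralSchur n d),
      ∀ t, (B t : S n d) = D.monomial L L' t := by
  classical
  refine exists_basis_of_leading _ (D.monomial_mem L L'
    (fun i j hij m => divPow_mem_integralSchur hij m) idem_mem_integralSchur) D.index
    D.exists_index_eq D.degree D.degree_index (fun r s r' s' h => ?_) (fun t r s hle h => ?_)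
    (fun t r s hle h => ?_)
  · obtain ⟨σ, hσ⟩ := exists_perm_of_card_fiber_eq
      (g := fun l => (r l, s l)) (g' := fun l => (r' l, s' l)) (D.cnt_eq_of_index_eq h)
    exact ⟨σ, funext fun l => (Prod.ext_iff.1 (congr_fun hσ l)).1,
      funext fun l => (Prod.ext_iff.1 (congr_fun hσ l)).2⟩
  · rw [D.mat_monomial hL hL' hall hall' t r s hle, if_pos h]
  · rw [D.mat_monomial hL hL' hall hall' t r s hle, if_neg h]

end RootSplit

/-! ### Commutation formulas for divided powers -/

section DividedPowers

variable {A : Type*} [Ring A] [Algebra ℚ A]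

/-- The divided power `y ^ m / m!` in a rational algebra. -/
def dpow (y : A) (m : ℕ) : A := ((m ! : ℚ)⁻¹) • y ^ m

theorem dpow_zero (y : A) : dpow y 0 = 1 := by simp [dpow]

theorem dpow_mul_self (y : A) (m : ℕ) : dpow y m * y = ((m + 1 : ℕ) : ℚ) • dpow y (m + 1) := by
  rw [dpow, dpow, smul_smul, smul_mul_assoc, ← pow_succ, Nat.factorial_succ]
  congr 1
  have : (m ! : ℚ) ≠ 0 := by positivity
  have : (m : ℚ) + 1 ≠ 0 := by positivity
  push_cast
  field_simp

theorem self_mul_dpow (y : A) (m : ℕ) : y * dpow y m = ((m + 1 : ℕ) : ℚ) • dpow y (m + 1) := by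
  rw [← dpow_mul_self, dpow, mul_smul_comm, smul_mul_assoc, pow_mul_comm']

theorem succ_smul_cancel (m : ℕ) {y z : A}
    (h : ((m + 1 : ℕ) : ℚ) • y = ((m + 1 : ℕ) : ℚ) • z) : y = z :=
  smul_right_injective A (by positivity : ((m + 1 : ℕ) : ℚ) ≠ 0) h

theorem commute_dpow_right {c a : A} (h : Commute c a) (m : ℕ) : Commute c (dpow a m) :=
  (h.pow_right m).smul_right _

theorem mul_dpow_succ_of_comm {a b c : A} (hab : a * b = b * a + c) (hcb : Commute c b) (q : ℕ) :
    a * dpow b (q + 1) = dpow b (q + 1) * a + c * dpow b q := by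
  induction q with
  | zero => simpa [dpow] using hab
  | succ q ih =>
    refine succ_smul_cancel (q + 1) ?_
    rw [← mul_smul_comm, ← dpow_mul_self, ← mul_assoc, ih, add_mul, mul_assoc, hab, mul_add,
      ← mul_assoc, dpow_mul_self, mul_assoc c, dpow_mul_self, ← (commute_dpow_right hcb _).eq,
      smul_mul_assoc, mul_smul_comm, smul_add, add_assoc]
    congr 1
    push_cast
    module

/-- Induction on `p`, multiplying by one more `a` on the left. After scaling by `p + 1 = t.1 + t.2`,
each coefficient splits into the contributions of `a` passing through and of `a` turning a `b` into
`c`. -/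
theorem dpow_mul_dpow_of_comm {a b c : A} (hab : a * b = b * a + c) (hca : Commute c a)
    (hcb : Commute c b) (p q : ℕ) :
    dpow a p * dpow b (q + p) = ∑ t ∈ Finset.HasAntidiagonal.antidiagonal p,
      dpow b (q + t.2) * dpow c t.1 * dpow a t.2 := by
  induction p generalizing q with
  | zero => simp [dpow_zero]
  | succ p ih =>
    refine succ_smul_cancel p ?_
    have h1 : ((p + 1 : ℕ) : ℚ) • (dpow a (p + 1) * dpow b (q + (p + 1))) =
        ∑ t ∈ Finset.HasAntidiagonal.antidiagonal p, (((t.2 + 1 : ℕ) : ℚ) •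
            (dpow b (q + (t.2 + 1)) * dpow c t.1 * dpow a (t.2 + 1)) +
          ((t.1 + 1 : ℕ) : ℚ) • (dpow b (q + t.2) * dpow c (t.1 + 1) * dpow a t.2)) := by
      rw [← smul_mul_assoc, ← self_mul_dpow, mul_assoc, show q + (p + 1) = q + 1 + p by ring, ih,
        Finset.mul_sum]
      refine Finset.sum_congr rfl fun t _ => ?_
      rw [show q + 1 + t.2 = q + t.2 + 1 by ring, ← mul_assoc, ← mul_assoc,
        mul_dpow_succ_of_comm hab hcb, add_mul, add_mul, mul_assoc (dpow b (q + t.2 + 1)) a,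
        ← (commute_dpow_right hca.symm t.1).eq.symm, ← mul_assoc, mul_assoc _ a, self_mul_dpow,
        mul_smul_comm, (commute_dpow_right hcb (q + t.2)).eq, mul_assoc (dpow b (q + t.2)) c,
        self_mul_dpow, mul_smul_comm, smul_mul_assoc, add_assoc]
    have h2 : ((p + 1 : ℕ) : ℚ) • ∑ t ∈ Finset.HasAntidiagonal.antidiagonal (p + 1),
        dpow b (q + t.2) * dpow c t.1 * dpow a t.2 =
        ∑ t ∈ Finset.HasAntidiagonal.antidiagonal (p + 1),
          (t.2 : ℚ) • (dpow b (q + t.2) * dpow c t.1 * dpow a t.2) +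
        ∑ t ∈ Finset.HasAntidiagonal.antidiagonal (p + 1),
          (t.1 : ℚ) • (dpow b (q + t.2) * dpow c t.1 * dpow a t.2) := by
      rw [← Finset.sum_add_distrib, Finset.smul_sum]
      refine Finset.sum_congr rfl fun t ht => ?_
      rw [← add_smul, ← Nat.cast_add, ← Finset.HasAntidiagonal.mem_antidiagonal.1 ht, add_comm t.2]
    rw [h1, h2, Finset.Nat.sum_antidiagonal_succ', Finset.Nat.sum_antidiagonal_succ,
      Finset.sum_add_distrib]
    simp

/-- With `q = 0`, the term `(m, 0)` of the commutation formula is `dpow c m` itself, and the other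
terms involve only smaller divided powers of `c`. -/
theorem dpow_mem_of_comm {C : Subring A} {a b c : A} (hab : a * b = b * a + c)
    (hca : Commute c a) (hcb : Commute c b) (ha : ∀ m, dpow a m ∈ C) (hb : ∀ m, dpow b m ∈ C)
    (m : ℕ) : dpow c m ∈ C := by
  induction m using Nat.strong_induction_on with
  | _ m ih =>
    have h := dpow_mul_dpow_of_comm hab hca hcb m 0
    rw [← Finset.add_sum_erase _ _ (show (m, 0) ∈ Finset.HasAntidiagonal.antidiagonal m by simp)] at h
    simp only [zero_add, dpow_zero, one_mul, mul_one] at h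
    rw [← sub_eq_iff_eq_add] at h
    rw [← h]
    refine C.sub_mem (C.mul_mem (ha m) (hb m)) (C.sum_mem fun t ht => ?_)
    rw [Finset.mem_erase, Finset.HasAntidiagonal.mem_antidiagonal] at ht
    refine C.mul_mem (C.mul_mem (hb _) (ih _ ?_)) (ha _)
    rcases t with ⟨t, u⟩
    have h1 := ht.1
    have h2 := ht.2
    simp only [ne_eq, Prod.mk.injEq] at h1 h2 ⊢
    omega

/-- Pascal's rule times `u` plus the absorption identity; it is the coefficient recursion behind the
`sl_2` formula. -/
theorem add_mul_choose_succ (y : ℤ) (u k : ℕ) :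
    ((k : ℤ) + 1 + u) * Ring.choose y (k + 1) =
      u * Ring.choose (y - 1) (k + 1) + (y + u) * Ring.choose (y - 1) k := by
  have h1 := Ring.choose_succ_succ (y - 1) k
  rw [sub_add_cancel] at h1
  have h2 := Ring.choose_smul_choose y (show 1 ≤ k + 1 by omega)
  simp only [Nat.choose_one_right, Ring.choose_one_right, Nat.cast_one, add_tsub_cancel_right,
    nsmul_eq_mul] at h2
  push_cast at h2
  linear_combination h2 + u * h1

/-- The function `x ↦ binom(x + z, k)` on the integers. -/
def chooseFun (z : ℤ) (k : ℕ) (x : ℤ) : ℚ := (Ring.choose (x + z) k : ℤ)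

variable (D : (ℤ → ℚ) →ₐ[ℚ] A) {e f : A}

theorem mul_dpow_succ_sl2 (hDf : ∀ g : ℤ → ℚ, D g * f = f * D (fun x => g (x - 2)))
    (hef : e * f = f * e + D fun x => x) (q : ℕ) :
    e * dpow f (q + 1) = dpow f (q + 1) * e + dpow f q * D (fun x => x - q) := by
  induction q with
  | zero => simpa [dpow] using hef
  | succ q ih =>
    refine succ_smul_cancel (q + 1) ?_
    rw [← mul_smul_comm, ← dpow_mul_self, ← mul_assoc, ih, add_mul, mul_assoc, hef, mul_add,
      ← mul_assoc, dpow_mul_self, mul_assoc _ (D _), hDf, ← mul_assoc, dpow_mul_self,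
      smul_mul_assoc, smul_add, add_assoc, smul_mul_assoc, ← mul_smul_comm _ _ (D _),
      ← map_smul, ← mul_add, ← map_add, ← mul_smul_comm _ _ (D _), ← map_smul]
    congr 3
    funext x
    simp only [Pi.add_apply, Pi.smul_apply, smul_eq_mul]
    push_cast
    ring

/-- Kostant's formula. Here `D` is a functional calculus for `h = [e, f]`, so that moving `e` or `f`
past a function of `h` shifts its argument by `2`. -/
theorem dpow_mul_dpow_sl2 (hDe : ∀ g : ℤ → ℚ, e * D g = D (fun x => g (x - 2)) * e)
    (hDf : ∀ g : ℤ → ℚ, D g * f = f * D (fun x => g (x - 2)))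
    (hef : e * f = f * e + D fun x => x) (p q : ℕ) :
    dpow e p * dpow f (q + p) = ∑ t ∈ Finset.HasAntidiagonal.antidiagonal p,
      dpow f (q + t.2) * D (chooseFun (-q - 2 * t.2) t.1) * dpow e t.2 := by
  induction p generalizing q with
  | zero =>
    have : chooseFun (-q) 0 = 1 := by funext x; simp [chooseFun]
    simp [dpow_zero, this]
  | succ p ih =>
    refine succ_smul_cancel p ?_
    have h1 : ((p + 1 : ℕ) : ℚ) • (dpow e (p + 1) * dpow f (q + (p + 1))) =
        ∑ t ∈ Finset.HasAntidiagonal.antidiagonal p,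
          (dpow f (q + (t.2 + 1)) * D (((t.2 + 1 : ℕ) : ℚ) •
              chooseFun (-q - 2 * (t.2 + 1 : ℕ) - 1) t.1) * dpow e (t.2 + 1) +
            dpow f (q + t.2) * D (fun x => (x - (q + t.2 : ℕ)) *
              chooseFun (-q - 2 * t.2 - 1) t.1 x) * dpow e t.2) := by
      rw [← smul_mul_assoc, ← self_mul_dpow, mul_assoc, show q + (p + 1) = q + 1 + p by ring, ih,
        Finset.mul_sum]
      refine Finset.sum_congr rfl fun t _ => ?_
      have e1 : (fun x => chooseFun (-(q + 1 : ℕ) - 2 * t.2) t.1 (x - 2)) =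
          chooseFun (-q - 2 * (t.2 + 1 : ℕ) - 1) t.1 := by
        funext x
        rw [chooseFun, chooseFun]
        congr 2
        push_cast
        ring
      have e2 : (fun x : ℤ => (x : ℚ) - (q + t.2 : ℕ)) * chooseFun (-(q + 1 : ℕ) - 2 * t.2) t.1 =
          fun x => (x - (q + t.2 : ℕ)) * chooseFun (-q - 2 * t.2 - 1) t.1 x := by
        funext x
        rw [Pi.mul_apply, chooseFun, chooseFun]
        congr 3
        push_cast
        ring
      rw [show q + 1 + t.2 = q + t.2 + 1 by ring, ← mul_assoc, ← mul_assoc,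
        mul_dpow_succ_sl2 D hDf hef, add_mul, add_mul, mul_assoc _ e, hDe, e1,
        mul_assoc (dpow f (q + t.2)) (D _), ← map_mul, e2]
      simp only [mul_assoc, self_mul_dpow, map_smul, mul_smul_comm, smul_mul_assoc, add_assoc]
    -- The first summand is chosen to match the terms where `e` passes through; the remainder is
    -- then identified by `add_mul_choose_succ`.
    have h2 : ((p + 1 : ℕ) : ℚ) • ∑ t ∈ Finset.HasAntidiagonal.antidiagonal (p + 1),
        dpow f (q + t.2) * D (chooseFun (-q - 2 * t.2) t.1) * dpow e t.2 =
        ∑ t ∈ Finset.HasAntidiagonal.antidiagonal (p + 1), dpow f (q + t.2) * D ((t.2 : ℚ) •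
          chooseFun (-q - 2 * t.2 - 1) t.1) * dpow e t.2 +
        ∑ t ∈ Finset.HasAntidiagonal.antidiagonal (p + 1), dpow f (q + t.2) * D (((t.1 + t.2 : ℕ) : ℚ) •
          chooseFun (-q - 2 * t.2) t.1 - (t.2 : ℚ) •
          chooseFun (-q - 2 * t.2 - 1) t.1) * dpow e t.2 := by
      rw [← Finset.sum_add_distrib, Finset.smul_sum]
      refine Finset.sum_congr rfl fun t ht => ?_
      rw [← add_mul, ← mul_add, ← map_add, add_sub_cancel, Finset.HasAntidiagonal.mem_antidiagonal.1 ht, map_smul,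
        mul_smul_comm, smul_mul_assoc]
    rw [h1, h2, Finset.Nat.sum_antidiagonal_succ', Finset.Nat.sum_antidiagonal_succ,
      Finset.sum_add_distrib]
    have h3 : ∀ t : ℕ × ℕ, ((t.1 + 1 + t.2 : ℕ) : ℚ) • chooseFun (-q - 2 * t.2) (t.1 + 1) -
        (t.2 : ℚ) • chooseFun (-q - 2 * t.2 - 1) (t.1 + 1) =
        fun x => (x - (q + t.2 : ℕ)) * chooseFun (-q - 2 * t.2 - 1) t.1 x := by
      intro t
      funext x
      have h := congr_arg (Int.cast (R := ℚ)) (add_mul_choose_succ (x + (-q - 2 * t.2)) t.2 t.1)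
      simp only [Pi.sub_apply, Pi.smul_apply, smul_eq_mul, chooseFun]
      rw [show x + (-q - 2 * t.2 - 1) = x + (-q - 2 * t.2) - 1 by ring]
      push_cast at h ⊢
      linear_combination h
    have h4 : ((p + 1 : ℕ) : ℚ) • chooseFun (-q - 2 * (p + 1 : ℕ)) 0 -
        ((p + 1 : ℕ) : ℚ) • chooseFun (-q - 2 * (p + 1 : ℕ) - 1) 0 = 0 := by
      funext x
      simp [chooseFun]
    simp only [h3, h4, Nat.cast_zero, zero_smul, map_zero, mul_zero, zero_mul, zero_add]

/-- By Vandermonde, a shifted binomial is an integral combination of unshifted ones of no larger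
degree. -/
theorem map_chooseFun_mem_of_le {C : Subring A} {k : ℕ}
    (h : ∀ l ≤ k, D (chooseFun 0 l) ∈ C) (z : ℤ) : D (chooseFun z k) ∈ C := by
  have : chooseFun z k = ∑ t ∈ Finset.HasAntidiagonal.antidiagonal k, (Ring.choose z t.2) • chooseFun 0 t.1 := by
    funext x
    rw [chooseFun, Ring.add_choose_eq k (Commute.all x z), Finset.sum_apply]
    push_cast
    refine Finset.sum_congr rfl fun t _ => ?_
    simp [chooseFun, mul_comm]
  rw [this, map_sum]
  refine C.sum_mem fun t ht => ?_
  rw [map_zsmul]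
  refine C.zsmul_mem (h _ ?_) _
  have := Finset.HasAntidiagonal.mem_antidiagonal.1 ht
  omega

theorem map_chooseFun_mem {C : Subring A}
    (hDe : ∀ g : ℤ → ℚ, e * D g = D (fun x => g (x - 2)) * e)
    (hDf : ∀ g : ℤ → ℚ, D g * f = f * D (fun x => g (x - 2)))
    (hef : e * f = f * e + D fun x => x) (he : ∀ m, dpow e m ∈ C) (hf : ∀ m, dpow f m ∈ C)
    (z : ℤ) (k : ℕ) : D (chooseFun z k) ∈ C := by
  refine map_chooseFun_mem_of_le D (fun l _ => ?_) z
  induction l using Nat.strong_induction_on with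
  | _ l ih =>
    have h := dpow_mul_dpow_sl2 D hDe hDf hef l 0
    -- The term `(l, 0)` is the binomial of degree `l` in `h`; all others have lower degree.
    rw [← Finset.add_sum_erase _ _ (show (l, 0) ∈ Finset.HasAntidiagonal.antidiagonal l by simp)] at h
    simp only [zero_add, dpow_zero, one_mul, mul_one, Nat.cast_zero, neg_zero, mul_zero,
      sub_zero] at h
    rw [← sub_eq_iff_eq_add] at h
    rw [← h]
    refine C.sub_mem (C.mul_mem (he l) (hf l)) (C.sum_mem fun t ht => ?_)
    rw [Finset.mem_erase, Finset.HasAntidiagonal.mem_antidiagonal] at ht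
    refine C.mul_mem (C.mul_mem (hf _)
      (map_chooseFun_mem_of_le D (fun l' hl' => ih l' ?_ ?_) _)) (he _) <;>
    · rcases t with ⟨t, u⟩
      have h1 := ht.1
      have h2 := ht.2
      simp only [ne_eq, Prod.mk.injEq] at h1 h2 hl'
      omega

end DividedPowers

/-! ### Lie algebra relations in the Schur algebra -/

theorem actAt_tprod_update {n d : ℕ} (X : Matrix (Fin n) (Fin n) ℚ) (k : Fin d)
    (v : Fin d → Fin n → ℚ) :
    actAt n d X k (PiTensorProduct.tprod ℚ v) =
      PiTensorProduct.tprod ℚ (Function.update v k (Matrix.toLin' X (v k))) := by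
  rw [actAt_tprod]
  congr 1
  funext l
  by_cases h : l = k
  · subst h; simp
  · simp [h]

theorem actAt_add {n d : ℕ} (X Y : Matrix (Fin n) (Fin n) ℚ) (k : Fin d) :
    actAt n d (X + Y) k = actAt n d X k + actAt n d Y k := by
  refine PiTensorProduct.ext (MultilinearMap.ext fun v => ?_)
  simp only [LinearMap.compMultilinearMap_apply, LinearMap.add_apply, actAt_tprod_update,
    map_add, MultilinearMap.map_update_add]

theorem actAt_mul_self {n d : ℕ} (X Y : Matrix (Fin n) (Fin n) ℚ) (k : Fin d) :
    actAt n d X k * actAt n d Y k = actAt n d (X * Y) k := by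
  refine PiTensorProduct.ext (MultilinearMap.ext fun v => ?_)
  simp [actAt_tprod_update, Matrix.toLin'_mul]

theorem actAt_mul_comm {n d : ℕ} (X Y : Matrix (Fin n) (Fin n) ℚ) {k l : Fin d} (h : k ≠ l) :
    actAt n d X k * actAt n d Y l = actAt n d Y l * actAt n d X k := by
  refine PiTensorProduct.ext (MultilinearMap.ext fun v => ?_)
  simp only [LinearMap.compMultilinearMap_apply, Module.End.mul_apply, actAt_tprod_update,
    Function.update_of_ne h, Function.update_of_ne h.symm]
  rw [Function.update_comm h]

/-- The action of matrices on the tensor power, as an additive map. -/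
def actHom (n d : ℕ) : Matrix (Fin n) (Fin n) ℚ →+ S n d where
  toFun := act n d
  map_zero' := by
    have h : act n d 0 = act n d 0 + act n d 0 := Subtype.ext (by
      simp [act, ← Finset.sum_add_distrib, ← actAt_add])
    simpa using h
  map_add' X Y := Subtype.ext (by simp [act, ← Finset.sum_add_distrib, ← actAt_add])

/-- Operators at different places commute, so only the diagonal of the double sum contributes to the
commutator. -/
theorem act_mul_act {n d : ℕ} (X Y : Matrix (Fin n) (Fin n) ℚ) :
    act n d X * act n d Y = act n d Y * act n d X + act n d (X * Y - Y * X) := by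
  have hsub : act n d (X * Y - Y * X) = act n d (X * Y) - act n d (Y * X) :=
    map_sub (actHom n d) _ _
  rw [hsub, ← sub_eq_iff_eq_add']
  refine Subtype.ext ?_
  simp only [act, AddSubgroupClass.coe_sub, MulMemClass.coe_mul, Finset.sum_mul_sum,
    ← actAt_mul_self]
  rw [Finset.sum_comm (γ := Fin d) (f := fun i j => actAt n d Y i * actAt n d X j),
    ← Finset.sum_sub_distrib, ← Finset.sum_sub_distrib]
  refine Finset.sum_congr rfl fun k _ => ?_
  rw [← Finset.sum_sub_distrib, Finset.sum_eq_single k]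
  · intro l _ hl
    rw [actAt_mul_comm X Y hl.symm, sub_self]
  · simp

theorem x_mul_x {n d : ℕ} {i k j : Fin n} (hij : i ≠ j) :
    x n d i k * x n d k j = x n d k j * x n d i k + x n d i j := by
  rw [x, x, act_mul_act, Matrix.single_mul_single_same,
    Matrix.single_mul_single_of_ne _ _ _ _ hij.symm, mul_one, sub_zero, x]

theorem x_commute {n d : ℕ} {i j k l : Fin n} (hjk : j ≠ k) (hil : i ≠ l) :
    Commute (x n d i j) (x n d k l) := by
  have h : act n d 0 = 0 := map_zero (actHom n d)
  rw [commute_iff_eq, x, x, act_mul_act, Matrix.single_mul_single_of_ne _ _ _ _ hjk,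
    Matrix.single_mul_single_of_ne _ _ _ _ hil.symm, sub_zero, h, add_zero]

theorem x_mul_x_swap {n d : ℕ} (i j : Fin n) :
    x n d i j * x n d j i = x n d j i * x n d i j + (H n d i - H n d j) := by
  have hsub : act n d (Matrix.single i i 1 - Matrix.single j j 1) = H n d i - H n d j :=
    map_sub (actHom n d) _ _
  rw [x, x, act_mul_act, Matrix.single_mul_single_same, Matrix.single_mul_single_same, mul_one,
    hsub]

theorem divPow_eq_dpow {n d : ℕ} (y : S n d) (m : ℕ) : divPow y m = dpow y m := rfl

theorem divPow_x_mem_of_mem {n d : ℕ} {C : Subring (S n d)} {i j k : Fin n} (hij : i ≠ j)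
    (hik : i ≠ k) (hkj : k ≠ j) (h1 : ∀ m, divPow (x n d i k) m ∈ C)
    (h2 : ∀ m, divPow (x n d k j) m ∈ C) (m : ℕ) : divPow (x n d i j) m ∈ C := by
  simp only [divPow_eq_dpow] at h1 h2 ⊢
  have h3 := x_mul_x (d := d) (k := k) hij
  have h4 : Commute (x n d i j) (x n d i k) := x_commute hij.symm hik
  have h5 : Commute (x n d i j) (x n d k j) := x_commute hkj.symm hij
  exact dpow_mem_of_comm h3 h4 h5 h1 h2 m

/-! ### The `sl_2` triples on weights -/

theorem mat_divPow_eq_dpow {n d : ℕ} (y : S n d) (m : ℕ) :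
    mat n d (divPow y m) = dpow (mat n d y) m := by
  rw [divPow, dpow, map_smul, map_pow]

/-- The diagonal matrix with entries the values of a function at `wt i - wt j`. -/
def diagDiff {n : ℕ} (d : ℕ) (i j : Fin n) :
    (ℤ → ℚ) →ₐ[ℚ] Matrix (Fin d → Fin n) (Fin d → Fin n) ℚ :=
  (Matrix.diagonalAlgHom ℚ).comp
    (AlgHom.pi fun s => Pi.evalAlgHom ℚ (fun _ => ℚ) ((wt s i : ℤ) - wt s j))

theorem diagDiff_apply {n d : ℕ} (i j : Fin n) (g : ℤ → ℚ) :
    diagDiff d i j g = Matrix.diagonal fun s => g ((wt s i : ℤ) - wt s j) := rfl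

theorem wt_eq_wt_update_add_one {n d : ℕ} {i j : Fin n} (hij : i ≠ j) {r : Fin d → Fin n}
    {k : Fin d} (h : r k = i) : wt r i = wt (Function.update r k j) i + 1 := by
  have : (Finset.univ.filter fun l => Function.update r k j l = i) =
      (Finset.univ.filter fun l => r l = i).erase k := by
    ext l
    by_cases hl : l = k
    · subst hl; simp [hij.symm]
    · simp [hl]
  rw [wt, wt, this, Finset.card_erase_add_one (by simpa using h)]

theorem mat_x_eq_zero_or {n d : ℕ} {i j : Fin n} (hij : i ≠ j) (r s : Fin d → Fin n) :
    mat n d (x n d i j) r s = 0 ∨ ((wt r i : ℤ) - wt r j) = (wt s i : ℤ) - wt s j + 2 := by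
  rw [mat_x]
  by_cases h : ∃ k, r k = i ∧ s = Function.update r k j
  · obtain ⟨k, h1, h2⟩ := h
    right
    have h3 := wt_eq_wt_update_add_one hij h1
    have h4 := wt_eq_wt_update_add_one hij.symm (r := s) (k := k) (by rw [h2]; simp)
    have h5 : Function.update s k i = r := by rw [h2, ← h1]; simp
    rw [← h2] at h3
    rw [h5] at h4
    omega
  · left
    exact Finset.sum_eq_zero fun k _ => if_neg fun hk => h ⟨k, hk⟩

theorem mat_x_mul_diagDiff {n d : ℕ} {i j : Fin n} (hij : i ≠ j) (g : ℤ → ℚ) :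
    mat n d (x n d i j) * diagDiff d i j g =
      diagDiff d i j (fun z => g (z - 2)) * mat n d (x n d i j) := by
  ext r s
  rw [diagDiff_apply, diagDiff_apply, Matrix.mul_diagonal, Matrix.diagonal_mul]
  rcases mat_x_eq_zero_or hij r s with h | h
  · simp [h]
  · rw [h, add_sub_cancel_right, mul_comm]

theorem diagDiff_mul_mat_x {n d : ℕ} {i j : Fin n} (hij : i ≠ j) (g : ℤ → ℚ) :
    diagDiff d i j g * mat n d (x n d j i) =
      mat n d (x n d j i) * diagDiff d i j (fun z => g (z - 2)) := by
  ext r s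
  rw [diagDiff_apply, diagDiff_apply, Matrix.mul_diagonal, Matrix.diagonal_mul]
  rcases mat_x_eq_zero_or hij.symm r s with h | h
  · simp [h]
  · rw [show (wt s i : ℤ) - wt s j - 2 = wt r i - wt r j by omega, mul_comm]

theorem mat_x_mul_mat_x_swap {n d : ℕ} (i j : Fin n) :
    mat n d (x n d i j) * mat n d (x n d j i) =
      mat n d (x n d j i) * mat n d (x n d i j) + diagDiff d i j (fun z => z) := by
  rw [← map_mul, x_mul_x_swap, map_add, map_mul, map_sub, mat_H, mat_H, diagDiff_apply,
    Matrix.diagonal_sub]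
  simp

theorem wt_le {n d : ℕ} (s : Fin d → Fin n) (k : Fin n) : wt s k ≤ d := by
  rw [wt]
  exact (Finset.card_le_univ _).trans (by simp)

theorem diagDiff_indicator_mem {n d : ℕ} {C : Subring (Matrix (Fin d → Fin n) (Fin d → Fin n) ℚ)}
    {i j : Fin n} (hij : i ≠ j) (h1 : ∀ m, dpow (mat n d (x n d i j)) m ∈ C)
    (h2 : ∀ m, dpow (mat n d (x n d j i)) m ∈ C) {a b : ℕ} (ha : a ≤ d) (hb : b ≤ d) :
    diagDiff d i j (fun z => if z = (a : ℤ) - b then 1 else 0) ∈ C := by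
  -- The first binomial vanishes below the value `a - b`, the second above it, and both are `1` at
  -- it. The shift by `d` makes the arguments natural numbers, since weights lie between `0` and
  -- `d`.
  have key : diagDiff d i j (fun z => if z = (a : ℤ) - b then 1 else 0) =
      diagDiff d i j (chooseFun d (a + d - b)) * diagDiff d j i (chooseFun d (b + d - a)) := by
    rw [diagDiff_apply, diagDiff_apply, diagDiff_apply, Matrix.diagonal_mul_diagonal]
    congr 1
    funext s
    have hi := wt_le s i
    have hj := wt_le s j
    rw [chooseFun, chooseFun, show (wt s i : ℤ) - wt s j + d = (wt s i + d - wt s j : ℕ) by omega,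
      show (wt s j : ℤ) - wt s i + d = (wt s j + d - wt s i : ℕ) by omega, Ring.choose_natCast,
      Ring.choose_natCast]
    split_ifs with h
    · rw [show wt s i + d - wt s j = a + d - b by omega,
        show wt s j + d - wt s i = b + d - a by omega]
      simp
    · rcases lt_or_gt_of_ne h with h | h
      · rw [Nat.choose_eq_zero_of_lt (show wt s i + d - wt s j < a + d - b by omega)]
        simp
      · rw [Nat.choose_eq_zero_of_lt (show wt s j + d - wt s i < b + d - a by omega)]
        simp
  rw [key]
  exact C.mul_mem
    (map_chooseFun_mem _ (mat_x_mul_diagDiff hij) (diagDiff_mul_mat_x hij)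
      (mat_x_mul_mat_x_swap i j) h1 h2 _ _)
    (map_chooseFun_mem _ (mat_x_mul_diagDiff hij.symm) (diagDiff_mul_mat_x hij.symm)
      (mat_x_mul_mat_x_swap j i) h2 h1 _ _)

/-! ### Generation by simple divided powers -/

theorem eq_of_sum_eq_of_sub_eq {n : ℕ} {u v : Fin n → ℕ} (hsum : ∑ k, u k = ∑ k, v k)
    (h : ∀ (k : ℕ) (hk : k + 1 < n), (u ⟨k, by omega⟩ : ℤ) - u ⟨k + 1, hk⟩ =
      v ⟨k, by omega⟩ - v ⟨k + 1, hk⟩) : u = v := by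
  rcases n with - | n
  · exact Subsingleton.elim _ _
  have hc : ∀ (k : ℕ) (hk : k < n + 1), (u ⟨k, hk⟩ : ℤ) - v ⟨k, hk⟩ = u 0 - v 0 := by
    intro k
    induction k with
    | zero => intro _; rfl
    | succ k ih =>
      intro hk
      have := ih (by omega)
      have := h k hk
      omega
  have h0 : ∑ k : Fin (n + 1), ((u k : ℤ) - v k) = 0 := by
    rw [Finset.sum_sub_distrib, sub_eq_zero]
    exact_mod_cast hsum
  rw [Finset.sum_congr rfl fun (k : Fin (n + 1)) _ => hc k.1 k.2, Finset.sum_const,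
    Finset.card_univ, Fintype.card_fin, smul_eq_zero] at h0
  have h00 := h0.resolve_left (by omega)
  funext k
  have := hc k.1 k.2
  simp only [Fin.eta] at this
  omega

/-- The generating divided powers of the simple root vectors. -/
def generators (n d : ℕ) : Set (S n d) :=
  {y | ∃ (j : Fin (n - 1)) (m : ℕ), y = divPow (e n d j) m ∨ y = divPow (f n d j) m}

theorem divPow_x_succ_mem_closure {n d k : ℕ} (hk : k + 1 < n) (m : ℕ) :
    divPow (x n d ⟨k, by omega⟩ ⟨k + 1, hk⟩) m ∈ Subring.closure (generators n d) :=
  Subring.subset_closure ⟨⟨k, by omega⟩, m, Or.inl rfl⟩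

theorem divPow_x_succ_mem_closure' {n d k : ℕ} (hk : k + 1 < n) (m : ℕ) :
    divPow (x n d ⟨k + 1, hk⟩ ⟨k, by omega⟩) m ∈ Subring.closure (generators n d) :=
  Subring.subset_closure ⟨⟨k, by omega⟩, m, Or.inr rfl⟩

theorem divPow_x_mem_closure {n d : ℕ} {i j : Fin n} (hij : i ≠ j) (m : ℕ) :
    divPow (x n d i j) m ∈ Subring.closure (generators n d) := by
  -- Induction on the height `δ + 1` of the root, splitting off its last simple root.
  have key : ∀ (δ k : ℕ) (hk : k + δ + 1 < n), ∀ m,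
      divPow (x n d ⟨k, by omega⟩ ⟨k + δ + 1, hk⟩) m ∈ Subring.closure (generators n d) ∧
      divPow (x n d ⟨k + δ + 1, hk⟩ ⟨k, by omega⟩) m ∈ Subring.closure (generators n d) := by
    intro δ
    induction δ with
    | zero =>
      intro k hk m
      exact ⟨divPow_x_succ_mem_closure hk m, divPow_x_succ_mem_closure' hk m⟩
    | succ δ ih =>
      intro k hk m
      have h := ih k (by omega)
      have ne1 : (⟨k, by omega⟩ : Fin n) ≠ ⟨k + (δ + 1) + 1, hk⟩ := by simp; omega
      have ne2 : (⟨k, by omega⟩ : Fin n) ≠ ⟨k + δ + 1, by omega⟩ := by simp; omega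
      have ne3 : (⟨k + δ + 1, by omega⟩ : Fin n) ≠ ⟨k + (δ + 1) + 1, hk⟩ := by simp
      exact ⟨divPow_x_mem_of_mem ne1 ne2 ne3 (fun m => (h m).1)
          (fun m => divPow_x_succ_mem_closure (k := k + δ + 1) hk m) m,
        divPow_x_mem_of_mem ne1.symm ne3.symm ne2.symm
          (fun m => divPow_x_succ_mem_closure' (k := k + δ + 1) hk m) (fun m => (h m).2) m⟩
  obtain ⟨i, hi⟩ := i
  obtain ⟨j, hj⟩ := j
  rcases lt_or_gt_of_ne (show i ≠ j by simpa using hij) with h | h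
  · obtain ⟨δ, rfl⟩ := Nat.exists_eq_add_of_lt h
    exact (key δ i hj m).1
  · obtain ⟨δ, rfl⟩ := Nat.exists_eq_add_of_lt h
    exact (key δ j hi m).2

theorem idem_mem_closure {n d : ℕ} (μ : Comp n d) :
    idem μ ∈ Subring.closure (generators n d) := by
  set C := (Subring.closure (generators n d)).map (mat n d).toRingHom with hC
  have hmem : ∀ y, mat n d y ∈ C ↔ y ∈ Subring.closure (generators n d) := fun y =>
    ⟨fun ⟨z, hz, h⟩ => mat_injective n d h ▸ hz, fun h => ⟨y, h, rfl⟩⟩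
  rw [← hmem, mat_idem]
  have hle : ∀ k, μ.1 k ≤ d := fun k =>
    (Finset.single_le_sum (fun _ _ => Nat.zero_le _) (Finset.mem_univ k)).trans μ.2.le
  -- The total weight is always `d`, so the consecutive differences detect `μ` on their own.
  have hprod : (fun s : Fin d → Fin n => if wt s = μ.1 then (1 : ℚ) else 0) =
      ∏ k : Fin (n - 1), fun s : Fin d → Fin n =>
        if (wt s ⟨k, by omega⟩ : ℤ) - wt s ⟨k + 1, by omega⟩ =
          μ.1 ⟨k, by omega⟩ - μ.1 ⟨k + 1, by omega⟩ then (1 : ℚ) else 0 := by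
    funext s
    rw [Finset.prod_apply]
    split_ifs with h
    · simp [h]
    · have hex : ∃ k : Fin (n - 1), ¬ ((wt s ⟨k, by omega⟩ : ℤ) - wt s ⟨k + 1, by omega⟩ =
          μ.1 ⟨k, by omega⟩ - μ.1 ⟨k + 1, by omega⟩) := by
        by_contra! hall
        exact h (eq_of_sum_eq_of_sub_eq (by rw [sum_wt, μ.2]) fun k hk => hall ⟨k, by omega⟩)
      obtain ⟨k, hk⟩ := hex
      exact (Finset.prod_eq_zero (Finset.mem_univ k) (if_neg hk)).symm
  rw [hprod]
  refine Subring.prod_mem (C.comap (Matrix.diagonalRingHom (Fin d → Fin n) ℚ)) fun k _ => ?_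
  refine diagDiff_indicator_mem (C := C) (i := ⟨k, by omega⟩) (j := ⟨k + 1, by omega⟩) (by simp)
    (fun m => ?_) (fun m => ?_) (hle _) (hle _)
  · rw [← mat_divPow_eq_dpow, hmem]
    exact divPow_x_succ_mem_closure _ m
  · rw [← mat_divPow_eq_dpow, hmem]
    exact divPow_x_succ_mem_closure' _ m

/-! ### The two triangular orders and the conclusion -/

theorem bijective_posRoot_pairs (n : ℕ) :
    Function.Bijective (Sum.elim
      (Sum.elim (fun α : PosRoot n => α.1) fun α : PosRoot n => α.1.swap)
      fun k : Fin n => (k, k)) := by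
  constructor
  · rintro ((⟨⟨a, b⟩, h⟩ | ⟨⟨a, b⟩, h⟩) | a) ((⟨⟨a', b'⟩, h'⟩ | ⟨⟨a', b'⟩, h'⟩) | a') he <;>
      try dsimp only at h
    all_goals try dsimp only at h'
    all_goals simp [-not_lt] at he ⊢
    all_goals omega
  · rintro ⟨i, j⟩
    rcases lt_trichotomy i j with h | h | h
    · exact ⟨Sum.inl (Sum.inl ⟨(i, j), h⟩), rfl⟩
    · exact ⟨Sum.inr i, by simp [h]⟩
    · exact ⟨Sum.inl (Sum.inr ⟨(j, i), h⟩), rfl⟩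

/-- The data for the monomials `e_A 1_λ f_C`. -/
def posSplit (n : ℕ) : RootSplit n (PosRoot n) where
  p α := α.1
  q α := α.1.swap
  mid P := max P.1 P.2
  bij := bijective_posRoot_pairs n
  mid_diag k := max_self k
  mid_p α := max_eq_right α.2.le
  mid_q α := max_eq_left α.2.le

/-- The data for the monomials `f_A 1_λ e_C`. -/
def negSplit (n : ℕ) : RootSplit n (PosRoot n) where
  p α := α.1.swap
  q α := α.1
  mid P := min P.1 P.2
  bij := by
    convert (bijective_posRoot_pairs n).comp
      ((Equiv.sumComm (PosRoot n) (PosRoot n)).sumCongr (Equiv.refl (Fin n))).bijective using 1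
    funext u
    rcases u with (α | α) | k <;> rfl
  mid_diag k := min_self k
  mid_p α := min_eq_right α.2.le
  mid_q α := min_eq_left α.2.le

theorem RootSplit.exists_basis_of_iff {n : ℕ} {ι : Type} [Fintype ι] (D : RootSplit n ι)
    {L L' : List ι} (hL : L.Nodup) (hL' : L'.Nodup) (hall : ∀ α, α ∈ L) (hall' : ∀ α, α ∈ L')
    (d : ℕ) {P : (ι → ℕ) × Comp n d × (ι → ℕ) → Prop}
    (hP : ∀ t, P t ↔ D.content t.1 t.2.2 ≤ t.2.1.1) :
    ∃ B : Module.Basis {t // P t} ℤ (integralSchur n d), ∀ t, (B t : S n d) =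
      rootProd d D.p L t.1.1 * idem t.1.2.1 * rootProd d D.q L' t.1.2.2 := by
  obtain ⟨B, hB⟩ := D.exists_basis hL hL' hall hall' d
  refine ⟨B.reindex (Equiv.subtypeEquivRight hP).symm, fun t => ?_⟩
  rw [Module.Basis.reindex_apply, hB]
  rfl

theorem eMon_val {n : ℕ} (d : ℕ) (L : List (PosRoot n)) (A : PosRoot n → ℕ) :
    (eMon L A).val d = rootProd d (fun α => α.1) L A := by
  rw [KostantMonomial.val, eMon, List.map_map]
  rfl

theorem fMon_val {n : ℕ} (d : ℕ) (L : List (PosRoot n)) (A : PosRoot n → ℕ) :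
    (fMon L A).val d = rootProd d (fun α => α.1.swap) L A := by
  rw [KostantMonomial.val, fMon, List.map_map]
  rfl

theorem content_eMon_append_fMon {n : ℕ} {L L' : List (PosRoot n)} (hL : L.Nodup)
    (hL' : L'.Nodup) (hall : ∀ α, α ∈ L) (hall' : ∀ α, α ∈ L') (A C : PosRoot n → ℕ) :
    KostantMonomial.content (eMon L A ++ fMon L' C) = (posSplit n).content A C := by
  rw [RootSplit.content, ← sum_map_single hL hall, ← sum_map_single hL' hall',
    KostantMonomial.content, List.map_append, List.sum_append, eMon, fMon, List.map_map,
    List.map_map]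
  rfl

theorem oppContent_fMon_append_eMon {n : ℕ} {L L' : List (PosRoot n)} (hL : L.Nodup)
    (hL' : L'.Nodup) (hall : ∀ α, α ∈ L) (hall' : ∀ α, α ∈ L') (A C : PosRoot n → ℕ) :
    KostantMonomial.oppContent (fMon L A ++ eMon L' C) = (negSplit n).content A C := by
  rw [RootSplit.content, ← sum_map_single hL hall, ← sum_map_single hL' hall',
    KostantMonomial.oppContent, List.map_append, List.sum_append, eMon, fMon, List.map_map,
    List.map_map]
  rfl

theorem closure_generators_eq {n d : ℕ} {L L' : List (PosRoot n)} (hL : L.Nodup)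
    (hL' : L'.Nodup) (hall : ∀ α, α ∈ L) (hall' : ∀ α, α ∈ L') :
    Subring.closure (generators n d) = integralSchur n d := by
  apply le_antisymm
  · rw [Subring.closure_le]
    rintro y ⟨j, m, rfl | rfl⟩
    · exact divPow_mem_integralSchur (by simp) m
    · exact divPow_mem_integralSchur (by simp) m
  -- Every member of the integral basis is a product of elements already shown to be generated.
  · intro T hT
    obtain ⟨B, hB⟩ := (posSplit n).exists_basis hL hL' hall hall' d
    have h : ∀ U : integralSchur n d, (U : S n d) ∈ Subring.closure (generators n d) := by
      intro U
      induction B.mem_span U using Submodule.span_induction with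
      | mem U hU =>
        obtain ⟨t, rfl⟩ := hU
        rw [hB]
        exact (posSplit n).monomial_mem L L' (fun i j hij => divPow_x_mem_closure hij)
          idem_mem_closure t
      | zero => exact Subring.zero_mem _
      | add U W _ _ hU hW => exact Subring.add_mem _ hU hW
      | smul c U _ hU => exact Subring.zsmul_mem _ hU c
    exact h ⟨T, hT⟩

end

end Schur

theorem theorem3 (n d : ℕ)
    (Lpos Lneg : List (Schur.PosRoot n))
    (hpos : Lpos.Nodup) (hpos_all : ∀ α, α ∈ Lpos)
    (hneg : Lneg.Nodup) (hneg_all : ∀ α, α ∈ Lneg) :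
    Subring.closure
        {y : Schur.S n d | ∃ (j : Fin (n - 1)) (m : ℕ),
          y = Schur.divPow (Schur.e n d j) m ∨ y = Schur.divPow (Schur.f n d j) m}
      = Schur.integralSchur n d ∧
    (∃ b : Module.Basis
        {t : (Schur.PosRoot n → ℕ) × Schur.Comp n d × (Schur.PosRoot n → ℕ) //
          Schur.KostantMonomial.content (Schur.eMon Lpos t.1 ++ Schur.fMon Lneg t.2.2) ≤ t.2.1.1}
        ℤ (Schur.integralSchur n d),
      ∀ t, (b t : Schur.S n d) =
        (Schur.eMon Lpos t.1.1).val d * Schur.idem t.1.2.1 * (Schur.fMon Lneg t.1.2.2).val d) ∧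
    (∃ b : Module.Basis
        {t : (Schur.PosRoot n → ℕ) × Schur.Comp n d × (Schur.PosRoot n → ℕ) //
          Schur.KostantMonomial.oppContent (Schur.fMon Lneg t.1 ++ Schur.eMon Lpos t.2.2) ≤
            t.2.1.1}
        ℤ (Schur.integralSchur n d),
      ∀ t, (b t : Schur.S n d) =
        (Schur.fMon Lneg t.1.1).val d * Schur.idem t.1.2.1 * (Schur.eMon Lpos t.1.2.2).val d) := by
  refine ⟨Schur.closure_generators_eq hpos hneg hpos_all hneg_all, ?_, ?_⟩
  · obtain ⟨B, hB⟩ := (Schur.posSplit n).exists_basis_of_iff hpos hneg hpos_all hneg_all d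
      fun t => iff_of_eq (congr_arg (· ≤ t.2.1.1)
        (Schur.content_eMon_append_fMon hpos hneg hpos_all hneg_all t.1 t.2.2))
    refine ⟨B, fun t => (hB t).trans ?_⟩
    rw [Schur.eMon_val, Schur.fMon_val]
    rfl
  · obtain ⟨B, hB⟩ := (Schur.negSplit n).exists_basis_of_iff hneg hpos hneg_all hpos_all d
      fun t => iff_of_eq (congr_arg (· ≤ t.2.1.1)
        (Schur.oppContent_fMon_append_eMon hneg hpos hneg_all hpos_all t.1 t.2.2))
    refine ⟨B, fun t => (hB t).trans ?_⟩
    rw [Schur.eMon_val, Schur.fMon_val]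
    rfl
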